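/- **Theorem 1 (Weak detection lower bound).** *Setting.* For each $k\in\mathbb N$ let $\mathcal D_k$ consist of a probability measure $P_X$ on a measurable space $\mathcal X$ and a probability measure $P_{XY}$ on $\mathcal X\times\mathcal X$ whose two marginals both equal $P_X$ (all of these may depend on $k$). Put $Q_{XY}=P_X\times P_X$ and assume that $P_{XY}\ll Q_{XY}$ and that the likelihood function $\mathcal L=\frac{dP_{XY}}{dQ_{XY}}$ is symmetric, $\mathcal L(x,y)=\mathcal L(y,x)$ for $Q_{XY}$-almost all $(x,y)$, and square integrable with respect to $Q_{XY}$. Then $(\mathcal Lf)(x)=\mathbb E_{Y\sim P_X}[\mathcal L(x,Y)f(Y)]$ is a self-adjoint Hilbert–Schmidt operator on $L^2(P_X)$; let $(\lambda_i)_{i\ge0}=(\lambda_i(\mathcal D_k))_{i\ge 0}$ be its eigenvalues listed with multiplicity (the nonzero ones, completed by zeros), where $\lambda_0$ is the largest one (it equals $1$). A term $\frac{\lambda_i^2}{1-\lambda_i^2}$ with $\lambda_i^2=1$ is read as $+\infty$. For integers $n=n_k$ and $d=d_k$ one observes databases $\mathsf X=(X_1,\dots,X_n)$ and $\mathsf Y=(Y_1,\dots,Y_n)$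 with rows in $\mathcal X^d$. Under $\mathcal H_0$ the pairs $(X_i,Y_i)$, $i\le n$, are i.i.d. with law $P_X^{\otimes d}\times P_X^{\otimes d}$; under $\mathcal H_1$ given a permutation $\sigma$ of $\{1,\dots,n\}$, the pairs $(X_i,Y_{\sigma(i)})$, $i\le n$, are i.i.d. with law $P_{XY}^{\otimes d}$. The minimax risk is $$\mathsf R^\star=\inf_{\phi}\Big(\mathbb P_{\mathcal H_0}[\phi(\mathsf X,\mathsf Y)=1]+\max_{\sigma}\mathbb P_{\mathcal H_1\mid\sigma}[\phi(\mathsf X,\mathsf Y)=0]\Big),$$ the infimum being over all measurable tests $\phi$ with values in $\{0,1\}$. A sequence $(\mathcal D_k,d_k,n_k)_k$ is admissible for weak detection if $\limsup_{k\to\infty}\mathsf R^\star<1$. *Claim.* Let $(\mathcal D_k,d_k,n_k)_k$ be a sequence such that $$\sum_{i\ge1}\frac{\lambda_i^2}{1-\lambda_i^2}=o(d^{-1}),\qquad\text{i.e.}\qquad d_k\sum_{i\ge1}\frac{\lambda_i(\mathcal D_k)^2}{1-\lambda_i(\mathcal D_k)^2}\to0\quad(k\to\infty).$$ 1. If $n_k\to\infty$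 and $d_k$ is an arbitrary function of $k$, then $\lim_{k\to\infty}\mathsf R^\star=1$. 2. If $n_k$ is constant and $d_k\to\infty$, then $\lim_{k\to\infty}\mathsf R^\star=1$. In both cases $(\mathcal D_k,d_k,n_k)_k$ is not admissible for weak detection. -/

import Mathlib

open MeasureTheory Filter Topology
open scoped ENNReal

namespace UnlabeledDatabases

/-- A pair of distributions for the database testing problem: a probability measure `PX` on `𝒳`
(the common marginal `P_X = P_Y`), and a joint distribution `PXY` on `𝒳 × 𝒳` with both marginals
equal to `PX`. With `Q_XY = P_X × P_X`, the likelihood function `L = dP_XY / dQ_XY` exists, is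
symmetric (it is determined up to `Q_XY`-null sets) and is square integrable under `Q_XY`. -/
structure DistributionPair (𝒳 : Type*) [MeasurableSpace 𝒳] where
  /-- the common marginal `P_X = P_Y` -/
  PX : Measure 𝒳
  /-- the joint distribution of a matched pair of entries -/
  PXY : Measure (𝒳 × 𝒳)
  isProb_PX : IsProbabilityMeasure PX
  isProb_PXY : IsProbabilityMeasure PXY
  fst_eq : PXY.fst = PX
  snd_eq : PXY.snd = PX
  ac : PXY ≪ PX.prod PX
  symm : ∀ᵐ p ∂(PX.prod PX),
    (PXY.rnDeriv (PX.prod PX) p.swap).toReal = (PXY.rnDeriv (PX.prod PX) p).toReal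
  sq_int : MemLp (fun p => (PXY.rnDeriv (PX.prod PX) p).toReal) 2 (PX.prod PX)

attribute [instance] DistributionPair.isProb_PX DistributionPair.isProb_PXY

section Kernel

variable {𝒳 : Type*} [MeasurableSpace 𝒳] {μ : Measure 𝒳} [IsProbabilityMeasure μ]

theorem ae_memLp_section {K : 𝒳 × 𝒳 → ℝ} (hK : MemLp K 2 (μ.prod μ)) :
    ∀ᵐ x ∂μ, MemLp (fun y => K (x, y)) 2 μ := by
  have h1 : ∀ᵐ x ∂μ, AEStronglyMeasurable (fun y => K (x, y)) μ := hK.1.prodMk_left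
  have h2 := hK.integrable_sq.prod_right_ae
  filter_upwards [h1, h2] with x hx1 hx2
  exact (memLp_two_iff_integrable_sq hx1).2 hx2

theorem ae_integrable_section_mul {K : 𝒳 × 𝒳 → ℝ} (hK : MemLp K 2 (μ.prod μ)) {f : 𝒳 → ℝ}
    (hf : MemLp f 2 μ) : ∀ᵐ x ∂μ, Integrable (fun y => K (x, y) * f y) μ := by
  filter_upwards [ae_memLp_section hK] with x hx
  exact hx.integrable_mul hf

theorem memLp_kernel_integral {K : 𝒳 × 𝒳 → ℝ} (hK : MemLp K 2 (μ.prod μ)) {f : 𝒳 → ℝ}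
    (hf : MemLp f 2 μ) : MemLp (fun x => ∫ y, K (x, y) * f y ∂μ) 2 μ := by
  have hm : AEStronglyMeasurable (fun x => ∫ y, K (x, y) * f y ∂μ) μ := by
    have : AEStronglyMeasurable (fun p : 𝒳 × 𝒳 => K p * f p.2) (μ.prod μ) :=
      hK.1.mul hf.1.comp_snd
    exact this.integral_prod_right'
  rw [memLp_two_iff_integrable_sq hm]
  have hI : Integrable (fun x => (∫ y, K (x, y) ^ 2 ∂μ) * ∫ y, f y ^ 2 ∂μ) μ :=
    hK.integrable_sq.integral_prod_left.mul_const _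
  refine hI.mono' (hm.pow 2) ?_
  filter_upwards [ae_memLp_section hK] with x hx
  have e1 : ∫ y, K (x, y) * f y ∂μ = inner ℝ (hx.toLp _) (hf.toLp _) := by
    rw [L2.inner_def]
    apply integral_congr_ae
    filter_upwards [hx.coeFn_toLp, hf.coeFn_toLp] with y h1 h2
    rw [h1, h2]
    simp [mul_comm]
  have e2 : ∀ {g : 𝒳 → ℝ} (hg : MemLp g 2 μ),
      inner ℝ (hg.toLp _) (hg.toLp _) = ∫ y, g y ^ 2 ∂μ := by
    intro g hg
    rw [L2.inner_def]
    apply integral_congr_ae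
    filter_upwards [hg.coeFn_toLp] with y h1
    rw [h1]
    simp [pow_two]
  rw [Real.norm_of_nonneg (sq_nonneg _), e1, ← e2 hx, ← e2 hf, pow_two]
  exact real_inner_mul_inner_self_le _ _

/-- The integral operator `f ↦ ∫ K(·, y) f(y) μ(dy)` on `L²(μ)` of a square-integrable kernel. -/
noncomputable def kernelOperator (K : 𝒳 × 𝒳 → ℝ) (hK : MemLp K 2 (μ.prod μ)) :
    Lp ℝ 2 μ →ₗ[ℝ] Lp ℝ 2 μ where
  toFun f := (memLp_kernel_integral hK (Lp.memLp f)).toLp (fun x => ∫ y, K (x, y) * f y ∂μ)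
  map_add' f g := by
    rw [← MemLp.toLp_add]
    apply MemLp.toLp_congr
    filter_upwards [ae_integrable_section_mul hK (Lp.memLp f),
      ae_integrable_section_mul hK (Lp.memLp g)] with x h1 h2
    rw [Pi.add_apply, ← integral_add h1 h2]
    apply integral_congr_ae
    filter_upwards [Lp.coeFn_add f g] with y hy
    rw [hy, Pi.add_apply, mul_add]
  map_smul' c f := by
    rw [RingHom.id_apply, ← MemLp.toLp_const_smul]
    apply MemLp.toLp_congr
    refine Eventually.of_forall fun x => ?_
    simp only [Pi.smul_apply, smul_eq_mul]
    rw [← integral_const_mul]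
    apply integral_congr_ae
    filter_upwards [Lp.coeFn_smul c f] with y hy
    rw [hy, Pi.smul_apply, smul_eq_mul]
    ring

end Kernel

/-- `lam` lists the eigenvalues of `T`: every nonzero real number occurs in the list as often as
its multiplicity (the dimension of its eigenspace) says, and `lam 0` is the largest one. Zero may
occur any number of times, so that a finite list of nonzero eigenvalues is completed by zeros. -/
structure IsEigenvalueList {E : Type*} [AddCommGroup E] [Module ℝ E] (T : E →ₗ[ℝ] E)
    (lam : ℕ → ℝ) : Prop where
  encard_eq : ∀ r : ℝ, r ≠ 0 →
    Set.encard {i | lam i = r} = Cardinal.toENat (Module.rank ℝ (Module.End.eigenspace T r))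
  le_zero : ∀ i, lam i ≤ lam 0

/-- `∑_{i ≥ 1} λ_i² / (1 - λ_i²)` in `[0, ∞]`; a term with `λ_i² = 1` is `∞`. -/
noncomputable def spectralSum (lam : ℕ → ℝ) : ℝ≥0∞ :=
  ∑' i : ℕ, ENNReal.ofReal (lam (i + 1) ^ 2) / ENNReal.ofReal (1 - lam (i + 1) ^ 2)

/-- An `n × d` database, with rows indexed by `Fin n`. -/
abbrev Database (𝒳 : Type*) (n d : ℕ) : Type _ := Fin n → Fin d → 𝒳

namespace DistributionPair

variable {𝒳 : Type*} [MeasurableSpace 𝒳] (D : DistributionPair 𝒳)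

/-- The product measure `Q_XY = P_X × P_Y`. -/
noncomputable def QXY : Measure (𝒳 × 𝒳) := D.PX.prod D.PX

/-- The single-letter likelihood function `L = dP_XY / dQ_XY`. -/
noncomputable def likelihood (p : 𝒳 × 𝒳) : ℝ := (D.PXY.rnDeriv D.QXY p).toReal

/-- The likelihood kernel operator `(L f)(x) = E_{Y ∼ P_Y}[L(x, Y) f(Y)]` on `L²(P_X)`. -/
noncomputable def likelihoodOperator : Lp ℝ 2 D.PX →ₗ[ℝ] Lp ℝ 2 D.PX :=
  kernelOperator D.likelihood D.sq_int

/-- The law of `(X, Y)` under `H₀`: all `n * d` entries of `X` and of `Y` are independent with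
law `P_X`. -/
noncomputable def nullLaw (n d : ℕ) : Measure (Database 𝒳 n d × Database 𝒳 n d) :=
  (Measure.pi fun _ => Measure.pi fun _ => D.PX).prod
    (Measure.pi fun _ => Measure.pi fun _ => D.PX)

/-- The law of `(X, Y)` under `H₁` given `σ`: the pairs of rows `(X_i, Y_{σ i})` are independent
with law `P_XY^{⊗ d}`. It is the image of the law of independent pairs `w i = (X_i, Y_{σ i})`. -/
noncomputable def altLaw (n d : ℕ) (σ : Equiv.Perm (Fin n)) :
    Measure (Database 𝒳 n d × Database 𝒳 n d) :=
  (Measure.pi fun _ : Fin n => Measure.pi fun _ : Fin d => D.PXY).map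
    fun w => (fun i l => (w i l).1, fun j l => (w (σ.symm j) l).2)

/-- The risk of a test: Type-I error plus worst-case Type-II error. Here `true` stands for the
decision `1`, and `false` for `0`. -/
noncomputable def risk (n d : ℕ) (φ : Database 𝒳 n d × Database 𝒳 n d → Bool) : ℝ≥0∞ :=
  D.nullLaw n d {z | φ z = true} + ⨆ σ : Equiv.Perm (Fin n), D.altLaw n d σ {z | φ z = false}

/-- The minimax risk: the infimum of the risk over all (measurable) tests. -/
noncomputable def minimaxRisk (n d : ℕ) : ℝ≥0∞ :=
  ⨅ (φ : Database 𝒳 n d × Database 𝒳 n d → Bool) (_ : Measurable φ), D.risk n d φ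

end DistributionPair

/-- A sequence `(D_k, d_k, n_k)` is admissible for weak detection if `limsup R* < 1`. -/
def AdmissibleForWeakDetection {𝒳 : ℕ → Type*} [∀ k, MeasurableSpace (𝒳 k)]
    (D : ∀ k, DistributionPair (𝒳 k)) (d n : ℕ → ℕ) : Prop :=
  limsup (fun k => (D k).minimaxRisk (n k) (d k)) atTop < 1

end UnlabeledDatabases

/-!
The lower bound is a second moment argument. Let `ℒ_σ` be the likelihood ratio of `H₁` given `σ`
against `H₀`. The worst-case Type-II error is at least the average one over all `σ`, so by
Cauchy–Schwarz the risk of any test is at least `1 - ε` as soon as the average of the `ℒ_σ` over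
`σ` has second moment at most `1 + ε²` under `H₀` (`DistributionPair.le_minimaxRisk`).

Expand the likelihood as `L(x, y) = ∑ λ_i φ_i(x) φ_i(y)` in orthonormal eigenfunctions. Then
`ℒ_σ(X, Y) = ∑_J Λ_J Φ_J(X) Φ_{J ∘ σ⁻¹}(Y)`, where `J` assigns to each of the `n` rows a
multi-index in `Fin d → ℕ`, and orthonormality leaves, in the second moment of the average, the sum
of `Λ_J²` over the coincidences `J ∘ σ = J ∘ τ`, divided by `n!²` (`integral_sum_perm_sq`). By a
Burnside count this is the complete homogeneous symmetric polynomial of degree `n` in the squared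
eigenvalues `a_I = ∏_l λ_{I_l}²` of the `d`-fold tensor power of the operator. One of these is `1`,
and the polynomial is at most `∏ 1 / (1 - a_I) ≤ exp (∑ a_I / (1 - a_I))` over the others
(`sum_fiberCount_prod_le`), for every `n`. Summing geometric series,
`∑ a_I / (1 - a_I) = ∑_{m ≥ 1} ((1 + ∑_{i ≥ 1} λ_i^{2m})^d - 1) ≤ d S exp (d S)` with
`S = ∑_{i ≥ 1} λ_i² / (1 - λ_i²)` (`sum_tensor_div_one_sub_le`). Hence the risk tends to `1` whenever
`d S → 0`, uniformly in `n` and `d`.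

To avoid infinite expansions of functions on databases, the computation is carried out for
truncations of `L` of finite rank; these converge to `L` in `L²`, and so do their tensor powers
(`DistributionPair.integral_prod_sub_prod_sq`). The truncations exist by the spectral theorem for
compact self-adjoint operators together with Parseval's identity in `L²(P_X × P_X)`, which gives
`∑ λ_i² = ‖L‖²` (`exists_finset_eigenvectors`). That `λ₀ = 1` is not an extra input: constants are
eigenfunctions with eigenvalue `1`, and finiteness of `S` leaves only the index `0` for it.
-/

namespace UnlabeledDatabases

/-! ### Elementary tensors and kernel operators on `L²(μ)` -/

section Tensor

theorem memLp_tensor {𝒳 : Type*} [MeasurableSpace 𝒳] {μ : Measure 𝒳} [SFinite μ]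
    {f g : 𝒳 → ℝ} (hf : MemLp f 2 μ)
    (hg : MemLp g 2 μ) :
    MemLp (fun p : 𝒳 × 𝒳 => f p.1 * g p.2) 2 (μ.prod μ) := by
  have hm : AEStronglyMeasurable (fun p : 𝒳 × 𝒳 => f p.1 * g p.2) (μ.prod μ) :=
    hf.1.comp_fst.mul hg.1.comp_snd
  rw [memLp_two_iff_integrable_sq hm]
  simpa only [mul_pow] using hf.integrable_sq.mul_prod hg.integrable_sq

variable {𝒳 : Type*} [MeasurableSpace 𝒳] {μ : Measure 𝒳} [IsProbabilityMeasure μ]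

/-- The elementary tensor `f ⊗ g`, that is `(x, y) ↦ f x * g y`, in `L²(μ × μ)`. -/
noncomputable def tensorLp (f g : Lp ℝ 2 μ) : Lp ℝ 2 (μ.prod μ) :=
  (memLp_tensor (Lp.memLp f) (Lp.memLp g)).toLp _

theorem coeFn_tensorLp (f g : Lp ℝ 2 μ) :
    tensorLp f g =ᵐ[μ.prod μ] fun p => f p.1 * g p.2 := MemLp.coeFn_toLp _

theorem real_inner_Lp {α : Type*} [MeasurableSpace α] {ν : Measure α} (f g : Lp ℝ 2 ν) :
    inner ℝ f g = ∫ x, f x * g x ∂ν := by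
  rw [L2.inner_def]
  simp [mul_comm]

theorem inner_tensorLp (f g f' g' : Lp ℝ 2 μ) :
    inner ℝ (tensorLp f g) (tensorLp f' g') = inner ℝ f f' * inner ℝ g g' := by
  rw [real_inner_Lp, real_inner_Lp, real_inner_Lp, ← integral_prod_mul]
  apply integral_congr_ae
  filter_upwards [coeFn_tensorLp f g, coeFn_tensorLp f' g'] with p h1 h2
  rw [h1, h2]
  ring

theorem norm_tensorLp (f g : Lp ℝ 2 μ) : ‖tensorLp f g‖ = ‖f‖ * ‖g‖ := by
  have h := inner_tensorLp f g f g
  simp only [real_inner_self_eq_norm_sq] at h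
  rw [← mul_pow] at h
  exact (sq_eq_sq₀ (norm_nonneg _) (by positivity)).1 h

/-- The tensor product `(f, g) ↦ f ⊗ g` as a bounded bilinear map into `L²(μ × μ)`. -/
noncomputable def tensorCLM (μ : Measure 𝒳) [IsProbabilityMeasure μ] :
    Lp ℝ 2 μ →L[ℝ] Lp ℝ 2 μ →L[ℝ] Lp ℝ 2 (μ.prod μ) :=
  LinearMap.mkContinuous₂
    (LinearMap.mk₂ ℝ tensorLp
      (fun f f' g => by
        apply Lp.ext
        have h := Measure.quasiMeasurePreserving_fst (μ := μ) (ν := μ) |>.ae (Lp.coeFn_add f f')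
        filter_upwards [coeFn_tensorLp (f + f') g, coeFn_tensorLp f g, coeFn_tensorLp f' g,
          Lp.coeFn_add (tensorLp f g) (tensorLp f' g), h] with p h1 h2 h3 h4 h5
        rw [h1, h4, Pi.add_apply, h2, h3, h5, Pi.add_apply, add_mul])
      (fun c f g => by
        apply Lp.ext
        have h := Measure.quasiMeasurePreserving_fst (μ := μ) (ν := μ) |>.ae (Lp.coeFn_smul c f)
        filter_upwards [coeFn_tensorLp (c • f) g, coeFn_tensorLp f g,
          Lp.coeFn_smul c (tensorLp f g), h] with p h1 h2 h4 h5
        rw [h1, h4, Pi.smul_apply, h2, h5, Pi.smul_apply, smul_eq_mul, smul_eq_mul, mul_assoc])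
      (fun f g g' => by
        apply Lp.ext
        have h := Measure.quasiMeasurePreserving_snd (μ := μ) (ν := μ) |>.ae (Lp.coeFn_add g g')
        filter_upwards [coeFn_tensorLp f (g + g'), coeFn_tensorLp f g, coeFn_tensorLp f g',
          Lp.coeFn_add (tensorLp f g) (tensorLp f g'), h] with p h1 h2 h3 h4 h5
        rw [h1, h4, Pi.add_apply, h2, h3, h5, Pi.add_apply, mul_add])
      (fun c f g => by
        apply Lp.ext
        have h := Measure.quasiMeasurePreserving_snd (μ := μ) (ν := μ) |>.ae (Lp.coeFn_smul c g)
        filter_upwards [coeFn_tensorLp f (c • g), coeFn_tensorLp f g,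
          Lp.coeFn_smul c (tensorLp f g), h] with p h1 h2 h4 h5
        rw [h1, h4, Pi.smul_apply, h2, h5, Pi.smul_apply, smul_eq_mul, smul_eq_mul,
          mul_left_comm]))
    1 (fun f g => by simp [norm_tensorLp])

@[simp] theorem tensorCLM_apply (f g : Lp ℝ 2 μ) : tensorCLM μ f g = tensorLp f g := rfl

/-- Elementary tensors are total in `L²(μ × μ)`: measurable rectangles generate the product
`σ`-algebra. -/
theorem eq_zero_of_inner_tensorLp_eq_zero {g : Lp ℝ 2 (μ.prod μ)}
    (h : ∀ a b : Lp ℝ 2 μ, inner ℝ (tensorLp a b) g = 0) : g = 0 := by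
  have hint : Integrable g (μ.prod μ) := (Lp.memLp g).integrable (by norm_num)
  have hrect : ∀ s t : Set 𝒳, MeasurableSet s → MeasurableSet t →
      ∫ p in s ×ˢ t, g p ∂(μ.prod μ) = 0 := by
    intro s t hs ht
    rw [← h (indicatorConstLp 2 hs (measure_ne_top μ s) 1)
      (indicatorConstLp 2 ht (measure_ne_top μ t) 1), real_inner_Lp,
      ← integral_indicator (hs.prod ht)]
    apply integral_congr_ae
    have h1 := Measure.quasiMeasurePreserving_fst (μ := μ) (ν := μ) |>.ae
      (indicatorConstLp_coeFn (p := 2) (hs := hs) (hμs := measure_ne_top μ s) (c := (1 : ℝ)))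
    have h2 := Measure.quasiMeasurePreserving_snd (μ := μ) (ν := μ) |>.ae
      (indicatorConstLp_coeFn (p := 2) (hs := ht) (hμs := measure_ne_top μ t) (c := (1 : ℝ)))
    filter_upwards [coeFn_tensorLp (indicatorConstLp 2 hs (measure_ne_top μ s) (1 : ℝ))
      (indicatorConstLp 2 ht (measure_ne_top μ t) 1), h1, h2] with p h3 h4 h5
    rw [h3, h4, h5]
    by_cases hp1 : p.1 ∈ s <;> by_cases hp2 : p.2 ∈ t <;> simp [Set.indicator, hp1, hp2]
  have hall : ∀ s : Set (𝒳 × 𝒳), MeasurableSet s → ∫ p in s, g p ∂(μ.prod μ) = 0 := by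
    intro s hs
    induction s, hs using MeasurableSpace.induction_on_inter generateFrom_prod.symm
      isPiSystem_prod with
    | empty => simp
    | basic t ht =>
      obtain ⟨a, ha, b, hb, rfl⟩ := ht
      exact hrect a b ha hb
    | compl t ht ih =>
      have h1 := integral_add_compl ht hint
      have h2 := hrect _ _ MeasurableSet.univ MeasurableSet.univ
      rw [Set.univ_prod_univ, setIntegral_univ] at h2
      rw [ih, h2, zero_add] at h1
      exact h1
    | iUnion t hd ht ih =>
      rw [integral_iUnion ht hd hint.integrableOn]
      simp [ih]
  have h0 := hint.ae_eq_zero_of_forall_setIntegral_eq_zero fun s hs _ => hall s hs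
  exact (Lp.eq_zero_iff_ae_eq_zero).2 h0

/-- The vector `T_K g` of `L²(μ)`, where `T_K` is the operator with kernel `K`; it is
characterised by `⟪T_K g, f⟫ = ⟪K, f ⊗ g⟫`. -/
noncomputable def kernelApply (K : Lp ℝ 2 (μ.prod μ)) (g : Lp ℝ 2 μ) : Lp ℝ 2 μ :=
  ContinuousLinearMap.adjoint ((tensorCLM μ).flip g) K

theorem inner_kernelApply (K : Lp ℝ 2 (μ.prod μ)) (f g : Lp ℝ 2 μ) :
    inner ℝ (kernelApply K g) f = inner ℝ K (tensorLp f g) := by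
  rw [kernelApply, ContinuousLinearMap.adjoint_inner_left]
  rfl

theorem norm_kernelApply_le (K : Lp ℝ 2 (μ.prod μ)) (g : Lp ℝ 2 μ) :
    ‖kernelApply K g‖ ≤ ‖K‖ * ‖g‖ := by
  have h := real_inner_le_norm K (tensorLp (kernelApply K g) g)
  rw [← inner_kernelApply, real_inner_self_eq_norm_sq, norm_tensorLp] at h
  rcases (norm_nonneg (kernelApply K g)).eq_or_lt with h0 | h0
  · rw [← h0]
    positivity
  · nlinarith

theorem tensorLp_add_right (f g g' : Lp ℝ 2 μ) :
    tensorLp f (g + g') = tensorLp f g + tensorLp f g' :=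
  (tensorCLM μ f).map_add g g'

theorem tensorLp_smul_right (c : ℝ) (f g : Lp ℝ 2 μ) :
    tensorLp f (c • g) = c • tensorLp f g :=
  (tensorCLM μ f).map_smul c g

/-- The operator on `L²(μ)` with kernel `K`, as a bounded linear function of `K`. -/
noncomputable def kernelCLM (μ : Measure 𝒳) [IsProbabilityMeasure μ] :
    Lp ℝ 2 (μ.prod μ) →L[ℝ] Lp ℝ 2 μ →L[ℝ] Lp ℝ 2 μ :=
  LinearMap.mkContinuous₂
    (LinearMap.mk₂ ℝ kernelApply
      (fun K K' g => ext_inner_right ℝ fun f => by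
        rw [inner_add_left, inner_kernelApply, inner_kernelApply, inner_kernelApply,
          inner_add_left])
      (fun c K g => ext_inner_right ℝ fun f => by
        rw [real_inner_smul_left, inner_kernelApply, inner_kernelApply, real_inner_smul_left])
      (fun K g g' => ext_inner_right ℝ fun f => by
        rw [inner_add_left, inner_kernelApply, inner_kernelApply, inner_kernelApply,
          tensorLp_add_right, inner_add_right])
      (fun c K g => ext_inner_right ℝ fun f => by
        rw [real_inner_smul_left, inner_kernelApply, inner_kernelApply, tensorLp_smul_right,
          real_inner_smul_right]))
    1 (fun K g => by
      rw [one_mul]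
      exact norm_kernelApply_le K g)

theorem inner_kernelCLM (K : Lp ℝ 2 (μ.prod μ)) (f g : Lp ℝ 2 μ) :
    inner ℝ (kernelCLM μ K g) f = inner ℝ K (tensorLp f g) :=
  inner_kernelApply K f g

theorem span_tensorLp_orthogonal :
    (Submodule.span ℝ {k : Lp ℝ 2 (μ.prod μ) | ∃ f g, tensorLp f g = k})ᗮ = ⊥ := by
  rw [Submodule.eq_bot_iff]
  intro k hk
  rw [Submodule.mem_orthogonal] at hk
  exact eq_zero_of_inner_tensorLp_eq_zero fun a b => hk _ (Submodule.subset_span ⟨a, b, rfl⟩)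

/-- A kernel operator is compact: it depends continuously on its kernel, elementary tensors give
operators of rank one, and they are total. -/
theorem isCompactOperator_kernelCLM (K : Lp ℝ 2 (μ.prod μ)) :
    IsCompactOperator (kernelCLM μ K) := by
  have hcl : IsClosed {K : Lp ℝ 2 (μ.prod μ) | IsCompactOperator (kernelCLM μ K)} :=
    (isClosed_setOfPred_isCompactOperator (𝕜₁ := ℝ) (𝕜₂ := ℝ) (σ₁₂ := RingHom.id ℝ)
      (M₁ := Lp ℝ 2 μ) (M₂ := Lp ℝ 2 μ)).preimage (kernelCLM μ).continuous
  have hd : Dense ((Submodule.span ℝ {k : Lp ℝ 2 (μ.prod μ) | ∃ f g, tensorLp f g = k} :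
      Submodule ℝ _) : Set (Lp ℝ 2 (μ.prod μ))) := by
    rw [Submodule.dense_iff_topologicalClosure_eq_top, ← Submodule.orthogonal_orthogonal_eq_closure,
      span_tensorLp_orthogonal, Submodule.bot_orthogonal_eq_top]
  have hsub : ((Submodule.span ℝ {k : Lp ℝ 2 (μ.prod μ) | ∃ f g, tensorLp f g = k} :
      Submodule ℝ _) : Set (Lp ℝ 2 (μ.prod μ))) ⊆ {K | IsCompactOperator (kernelCLM μ K)} := by
    intro k hk
    induction hk using Submodule.span_induction with
    | mem x hx =>
      obtain ⟨f, g, rfl⟩ := hx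
      have : kernelCLM μ (tensorLp f g) =
          (ContinuousLinearMap.toSpanSingleton ℝ f).comp (innerSL ℝ g) := by
        ext1 h
        apply ext_inner_right ℝ
        intro v
        rw [inner_kernelCLM, inner_tensorLp]
        simp [inner_smul_left, mul_comm]
      change IsCompactOperator (kernelCLM μ (tensorLp f g))
      rw [this]
      have hr : IsCompactOperator (innerSL ℝ g) := isCompactOperator_of_locallyCompactSpace_dom _
      exact hr.clm_comp (ContinuousLinearMap.toSpanSingleton ℝ f)
    | zero => simpa using isCompactOperator_zero
    | add x y _ _ hx hy =>
      change IsCompactOperator (kernelCLM μ (x + y))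
      rw [map_add]
      exact IsCompactOperator.add hx hy
    | smul a x _ hx =>
      change IsCompactOperator (kernelCLM μ (a • x))
      rw [map_smul]
      exact IsCompactOperator.smul hx a
  have := hcl.closure_subset_iff.2 hsub
  rw [hd.closure_eq] at this
  exact this (Set.mem_univ K)

/-- Elementary tensors of a Hilbert basis of `L²(μ)` give the Parseval identity in `L²(μ × μ)`. -/
theorem hasSum_inner_tensorLp_sq {κ : Type*} (b : HilbertBasis κ ℝ (Lp ℝ 2 μ))
    (K : Lp ℝ 2 (μ.prod μ)) :
    HasSum (fun p : κ × κ => inner ℝ K (tensorLp (b p.1) (b p.2)) ^ 2) (‖K‖ ^ 2) := by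
  classical
  have hon : Orthonormal ℝ (fun p : κ × κ => tensorLp (b p.1) (b p.2)) := by
    rw [orthonormal_iff_ite]
    rintro ⟨i, j⟩ ⟨i', j'⟩
    have h := orthonormal_iff_ite.1 b.orthonormal
    rw [inner_tensorLp, h, h]
    by_cases h1 : i = i' <;> by_cases h2 : j = j' <;> simp [h1, h2]
  have hbot : (Submodule.span ℝ (Set.range fun p : κ × κ => tensorLp (b p.1) (b p.2)))ᗮ = ⊥ := by
    rw [Submodule.eq_bot_iff]
    intro k hk
    rw [Submodule.mem_orthogonal] at hk
    apply eq_zero_of_inner_tensorLp_eq_zero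
    -- `⟪a ⊗ c, k⟫` is a bounded functional of each argument, so it is enough to test `a` and `c`
    -- on the basis, one after the other
    have h1 : ∀ i, ((tensorCLM μ (b i)).adjoint k) = 0 := by
      intro i
      apply b.repr.injective
      rw [map_zero]
      ext j
      rw [b.repr_apply_apply, ContinuousLinearMap.adjoint_inner_right]
      simpa using hk _ (Submodule.subset_span ⟨(i, j), rfl⟩)
    intro a c
    have h2 : ((tensorCLM μ).flip c).adjoint k = 0 := by
      apply b.repr.injective
      rw [map_zero]
      ext i
      rw [b.repr_apply_apply, ContinuousLinearMap.adjoint_inner_right,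
        ContinuousLinearMap.flip_apply, ← ContinuousLinearMap.adjoint_inner_right, h1]
      simp
    have := ContinuousLinearMap.adjoint_inner_right ((tensorCLM μ).flip c) a k
    rw [h2, inner_zero_right] at this
    simpa using this.symm
  have h := (HilbertBasis.mkOfOrthogonalEqBot hon hbot).hasSum_inner_mul_inner K K
  rw [real_inner_self_eq_norm_sq] at h
  refine h.congr_fun fun p => ?_
  simp [real_inner_comm K, sq]

end Tensor

/-! ### Spectral decomposition of the likelihood operator -/

section Spectral

universe u

/-- A compact symmetric operator on a Hilbert space has a Hilbert basis of eigenvectors. -/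
theorem exists_hilbertBasis_eigenvectors {E : Type u} [NormedAddCommGroup E]
    [InnerProductSpace ℝ E] [CompleteSpace E] {T : E →L[ℝ] E} (hT : IsCompactOperator T)
    (hs : T.IsSymmetric) :
    ∃ (κ : Type u) (b : HilbertBasis κ ℝ E) (ρ : κ → ℝ), ∀ i, T (b i) = ρ i • b i := by
  have hc : ∀ r : ℝ, CompleteSpace (Module.End.eigenspace (T : Module.End ℝ E) r) := by
    intro r
    have : IsClosed (Module.End.eigenspace (T : Module.End ℝ E) r : Set E) := by
      have h : (Module.End.eigenspace (T : Module.End ℝ E) r : Set E) = {x | T x = r • x} := by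
        ext x
        simp
      rw [h]
      exact isClosed_eq T.continuous (continuous_const_smul r)
    exact this.completeSpace_coe
  choose w b hb using fun r : ℝ =>
    exists_hilbertBasis ℝ (Module.End.eigenspace (T : Module.End ℝ E) r)
  have hon := hs.orthogonalFamily_eigenspaces.orthonormal_sigma_orthonormal
    (fun r => (b r).orthonormal)
  refine ⟨Σ r, w r, HilbertBasis.mkOfOrthogonalEqBot hon ?_, fun i => i.1, fun i => ?_⟩
  · rw [Submodule.eq_bot_iff]
    intro v hv
    rw [Submodule.mem_orthogonal'] at hv
    have h0 := ContinuousLinearMap.orthogonalComplement_iSup_eigenspaces_eq_bot hT hs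
    rw [← Submodule.mem_bot ℝ, ← h0, ← Submodule.iInf_orthogonal, Submodule.mem_iInf]
    intro r
    rw [Submodule.mem_orthogonal']
    intro x hx
    have h1 := ((b r).hasSum_repr ⟨x, hx⟩).mapL
      ((innerSL ℝ v).comp (Module.End.eigenspace (T : Module.End ℝ E) r).subtypeL)
    have h2 : ∀ i, ((innerSL ℝ v).comp (Module.End.eigenspace (T : Module.End ℝ E) r).subtypeL)
        ((b r).repr ⟨x, hx⟩ i • b r i) = 0 := by
      intro i
      rw [map_smul]
      have := hv _ (Submodule.subset_span ⟨⟨r, i⟩, rfl⟩)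
      simp only [ContinuousLinearMap.comp_apply, innerSL_apply_apply, Submodule.subtypeL_apply]
      simp at this
      simp [this]
    simp only [h2] at h1
    simpa using h1.unique hasSum_zero
  · rw [HilbertBasis.coe_mkOfOrthogonalEqBot]
    exact Module.End.mem_eigenspace_iff.1 (b i.1 i.2).2

variable {𝒳 : Type*} [MeasurableSpace 𝒳] (D : DistributionPair 𝒳)

namespace DistributionPair

/-- The likelihood function as an element of `L²(Q_XY)`. -/
noncomputable def likelihoodLp : Lp ℝ 2 (D.PX.prod D.PX) :=
  MemLp.toLp D.likelihood D.sq_int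

theorem inner_likelihoodLp_tensorLp (f g : Lp ℝ 2 D.PX) :
    inner ℝ D.likelihoodLp (tensorLp f g) =
      ∫ p, D.likelihood p * (f p.1 * g p.2) ∂(D.PX.prod D.PX) := by
  rw [real_inner_Lp]
  apply integral_congr_ae
  filter_upwards [coeFn_tensorLp f g, MemLp.coeFn_toLp D.sq_int] with p h1 h2
  rw [h1, likelihoodLp]
  exact congrArg (· * _) h2

theorem integrable_likelihood_mul (f g : Lp ℝ 2 D.PX) :
    Integrable (fun p => D.likelihood p * (f p.1 * g p.2)) (D.PX.prod D.PX) :=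
  MemLp.integrable_mul D.sq_int (memLp_tensor (Lp.memLp f) (Lp.memLp g))

theorem inner_likelihoodOperator (f g : Lp ℝ 2 D.PX) :
    inner ℝ (D.likelihoodOperator g) f = inner ℝ D.likelihoodLp (tensorLp f g) := by
  rw [inner_likelihoodLp_tensorLp, integral_prod _ (D.integrable_likelihood_mul f g),
    real_inner_Lp]
  apply integral_congr_ae
  filter_upwards [(memLp_kernel_integral D.sq_int (Lp.memLp g)).coeFn_toLp] with x hx
  have : (D.likelihoodOperator g : 𝒳 → ℝ) x = ∫ y, D.likelihood (x, y) * g y ∂D.PX := hx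
  rw [this, ← integral_mul_const]
  congr 1
  ext y
  ring

theorem likelihoodOperator_eq :
    D.likelihoodOperator = (kernelCLM D.PX D.likelihoodLp : Lp ℝ 2 D.PX →ₗ[ℝ] Lp ℝ 2 D.PX) := by
  ext1 g
  apply ext_inner_right ℝ
  intro f
  rw [inner_likelihoodOperator]
  exact (inner_kernelCLM _ _ _).symm

theorem inner_likelihoodLp_comm (f g : Lp ℝ 2 D.PX) :
    inner ℝ D.likelihoodLp (tensorLp f g) = inner ℝ D.likelihoodLp (tensorLp g f) := by
  rw [inner_likelihoodLp_tensorLp, inner_likelihoodLp_tensorLp, ← integral_prod_swap]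
  apply integral_congr_ae
  filter_upwards [D.symm] with p hp
  change D.likelihood p.swap = D.likelihood p at hp
  rw [hp]
  simp [mul_comm]

theorem isSymmetric_kernelCLM : (kernelCLM D.PX D.likelihoodLp).IsSymmetric := by
  intro f g
  change inner ℝ (kernelCLM D.PX D.likelihoodLp f) g = inner ℝ f (kernelCLM D.PX D.likelihoodLp g)
  rw [inner_kernelCLM, inner_likelihoodLp_comm, ← inner_kernelCLM]
  exact real_inner_comm _ _

theorem withDensity_likelihood :
    (D.PX.prod D.PX).withDensity (fun p => ENNReal.ofReal (D.likelihood p)) = D.PXY := by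
  rw [← Measure.withDensity_rnDeriv_eq _ _ D.ac]
  apply withDensity_congr_ae
  filter_upwards [D.PXY.rnDeriv_ne_top (D.PX.prod D.PX)] with p hp
  exact ENNReal.ofReal_toReal hp

/-- The constant function `1` is an eigenvector with eigenvalue `1`, because both marginals of
`P_XY` are `P_X`. -/
theorem kernelCLM_likelihood_one :
    kernelCLM D.PX D.likelihoodLp (Lp.const 2 D.PX (1 : ℝ)) = Lp.const 2 D.PX (1 : ℝ) := by
  apply ext_inner_right ℝ
  intro f
  rw [inner_kernelCLM, inner_likelihoodLp_tensorLp, real_inner_Lp]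
  have h1 : ∫ p, D.likelihood p * (f p.1 * (Lp.const 2 D.PX (1 : ℝ)) p.2) ∂(D.PX.prod D.PX) =
      ∫ p, D.likelihood p * f p.1 ∂(D.PX.prod D.PX) := by
    simp
  have h2 : ∫ x, (Lp.const 2 D.PX (1 : ℝ)) x * f x ∂D.PX = ∫ x, f x ∂D.PX := by
    simp
  rw [h1, h2]
  have h3 : ∫ x, f x ∂D.PX = ∫ p, f p.1 ∂D.PXY := by
    have h4 : ∫ x, f x ∂D.PX = ∫ x, f x ∂(D.PXY.map Prod.fst) :=
      congrArg (fun ν : Measure 𝒳 => ∫ x, (f : 𝒳 → ℝ) x ∂ν) D.fst_eq.symm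
    rw [h4]
    refine integral_map measurable_fst.aemeasurable ?_
    rw [show D.PXY.map Prod.fst = D.PX from D.fst_eq]
    exact (Lp.memLp f).1
  rw [h3]
  conv_rhs => rw [← D.withDensity_likelihood]
  rw [integral_withDensity_eq_integral_toReal_smul]
  · apply integral_congr_ae
    refine Eventually.of_forall fun p => ?_
    simp only [smul_eq_mul]
    rw [ENNReal.toReal_ofReal (show 0 ≤ D.likelihood p from ENNReal.toReal_nonneg)]
  · exact (Measure.measurable_rnDeriv _ _).ennreal_toReal.ennreal_ofReal
  · exact Eventually.of_forall fun _ => ENNReal.ofReal_lt_top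

end DistributionPair

/-- An eigenvalue `1` at a positive index would make a term of the spectral sum infinite. -/
theorem eq_zero_of_spectralSum_ne_top {lam : ℕ → ℝ} (h : spectralSum lam ≠ ⊤) {i : ℕ}
    (hi : lam i = 1) : i = 0 := by
  by_contra h0
  obtain ⟨j, rfl⟩ := Nat.exists_eq_succ_of_ne_zero h0
  apply ENNReal.ne_top_of_tsum_ne_top h j
  simp only [Nat.succ_eq_add_one] at hi
  simp [hi]

/-- Linearly independent eigenvectors are not more numerous than the eigenvalue list says. -/
theorem IsEigenvalueList.encard_le {E : Type*} [AddCommGroup E] [Module ℝ E] {T : E →ₗ[ℝ] E}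
    {lam : ℕ → ℝ} (hlam : IsEigenvalueList T lam) {κ : Type*} {v : κ → E}
    (hv : LinearIndependent ℝ v) {r : ℝ} (hr : r ≠ 0) (s : Finset κ)
    (hs : ∀ i ∈ s, T (v i) = r • v i) :
    (s : Set κ).encard ≤ {i | lam i = r}.encard := by
  rw [hlam.encard_eq r hr, Set.encard_coe_eq_coe_finsetCard, Cardinal.natCast_le_toENat]
  have h1 : LinearIndependent ℝ (fun i : s => (⟨v i, Module.End.mem_eigenspace_iff.2
      (hs i i.2)⟩ : Module.End.eigenspace T r)) := by
    apply LinearIndependent.of_comp (Module.End.eigenspace T r).subtype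
    exact hv.comp _ Subtype.val_injective
  have := h1.cardinal_lift_le_rank
  simpa using this

/-- Finitely many of the listed eigenvalues, with orthonormal eigenfunctions and including the
trivial eigenvalue `λ₀ = 1`, exhaust the squared Hilbert–Schmidt norm up to `ε`. -/
theorem exists_finset_eigenvectors (D : DistributionPair 𝒳) {lam : ℕ → ℝ}
    (hlam : IsEigenvalueList D.likelihoodOperator lam) (hS : spectralSum lam ≠ ⊤)
    {ε : ℝ} (hε : 0 < ε) :
    lam 0 = 1 ∧ ∃ s : Finset ℕ, 0 ∈ s ∧ ∃ φ : s → Lp ℝ 2 D.PX, Orthonormal ℝ φ ∧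
      (∀ i : s, kernelCLM D.PX D.likelihoodLp (φ i) = lam i • φ i) ∧
      |∑ i ∈ s, lam i ^ 2 - ‖D.likelihoodLp‖ ^ 2| < ε := by
  classical
  rw [D.likelihoodOperator_eq] at hlam
  obtain ⟨κ, b, ρ, hb⟩ := exists_hilbertBasis_eigenvectors
    (isCompactOperator_kernelCLM D.likelihoodLp) D.isSymmetric_kernelCLM
  have hbon := orthonormal_iff_ite.1 b.orthonormal
  have hK : HasSum (fun i => ρ i ^ 2) (‖D.likelihoodLp‖ ^ 2) := by
    have h := hasSum_inner_tensorLp_sq b D.likelihoodLp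
    have hinj : Function.Injective (fun i : κ => (i, i)) := fun i j hij => (Prod.ext_iff.1 hij).1
    rw [← hinj.hasSum_iff] at h
    · convert h using 2 with i
      simp only [Function.comp_apply]
      rw [← inner_kernelCLM, hb, real_inner_smul_left, hbon]
      simp
    · rintro ⟨i, j⟩ hij
      have hne : j ≠ i := fun h => hij ⟨i, by simp [h]⟩
      simp only
      rw [← inner_kernelCLM, hb, real_inner_smul_left, hbon, if_neg hne]
      simp
  -- otherwise the constant `1` would be orthogonal to all basis vectors
  obtain ⟨i₀, hi₀⟩ : ∃ i, ρ i = 1 := by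
    by_contra! hne
    have h0 : Lp.const 2 D.PX (1 : ℝ) = 0 := by
      apply b.repr.injective
      rw [map_zero]
      ext i
      rw [b.repr_apply_apply]
      have h1 := D.isSymmetric_kernelCLM (b i) (Lp.const 2 D.PX (1 : ℝ))
      simp only [ContinuousLinearMap.coe_coe] at h1
      rw [hb, D.kernelCLM_likelihood_one, real_inner_smul_left] at h1
      have h2 : (ρ i - 1) * inner ℝ (b i) (Lp.const 2 D.PX (1 : ℝ)) = 0 := by
        rw [sub_mul, one_mul, h1, sub_self]
      rcases mul_eq_zero.1 h2 with h3 | h3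
      · exact absurd (sub_eq_zero.1 h3) (hne i)
      · simpa using h3
    have h2 := congrArg norm h0
    rw [Lp.norm_const _ _ _ (by norm_num)] at h2
    simp at h2
  obtain ⟨F, hF⟩ := ((hK.eventually (Metric.ball_mem_nhds _ hε)).and
    (eventually_ge_atTop {i₀})).exists
  obtain ⟨hFε, hFi⟩ := hF
  -- zero eigenvalues are dropped, since the list records multiplicities only of nonzero ones
  set G := F.filter (fun i => ρ i ≠ 0) with hG
  have hi₀G : i₀ ∈ G := by
    rw [hG, Finset.mem_filter]
    exact ⟨hFi (Finset.mem_singleton_self _), by rw [hi₀]; norm_num⟩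
  -- inject the chosen basis vectors of each eigenvalue `r` into the positions of `r` in the list
  have hemb : ∀ r : ℝ, ∃ f : κ → ℕ, r ≠ 0 →
      (∀ i ∈ G.filter (fun i => ρ i = r), lam (f i) = r) ∧
      Set.InjOn f (G.filter (fun i => ρ i = r) : Finset κ) := by
    intro r
    by_cases hr : r = 0
    · exact ⟨fun _ => 0, fun h => absurd hr h⟩
    · obtain ⟨f, hf1, hf2⟩ := Set.Finite.exists_injOn_of_encard_le (Finset.finite_toSet _)
        (hlam.encard_le b.orthonormal.linearIndependent hr (G.filter (fun i => ρ i = r))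
          (fun i hi => by
            rw [← (Finset.mem_filter.1 hi).2]
            exact hb i))
      exact ⟨f, fun _ => ⟨fun i hi => hf1 hi, hf2⟩⟩
  choose f hf using hemb
  set e : κ → ℕ := fun i => f (ρ i) i with he
  have hmem : ∀ i ∈ G, ρ i ≠ 0 := fun i hi => (Finset.mem_filter.1 hi).2
  have hle : ∀ i ∈ G, lam (e i) = ρ i := fun i hi =>
    (hf _ (hmem i hi)).1 i (Finset.mem_filter.2 ⟨hi, rfl⟩)
  have hinj : Set.InjOn e G := by
    intro i hi j hj hij
    have hρ : ρ i = ρ j := by rw [← hle i hi, ← hle j hj, hij]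
    apply (hf _ (hmem i hi)).2 (Finset.mem_coe.2 (Finset.mem_filter.2 ⟨hi, rfl⟩))
      (Finset.mem_coe.2 (Finset.mem_filter.2 ⟨hj, hρ.symm⟩))
    simpa [he, hρ] using hij
  have he0 : e i₀ = 0 := eq_zero_of_spectralSum_ne_top hS (by rw [hle _ hi₀G, hi₀])
  refine ⟨by rw [← he0, hle _ hi₀G, hi₀], G.image e, Finset.mem_image.2 ⟨i₀, hi₀G, he0⟩, ?_⟩
  have hpre : ∀ j : G.image e, ∃ i ∈ G, e i = j := fun j => Finset.mem_image.1 j.2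
  choose g hgG hge using hpre
  have hginj : Function.Injective g := fun j j' h => Subtype.ext (by rw [← hge, ← hge, h])
  refine ⟨fun j => b (g j), b.orthonormal.comp g hginj, fun j => ?_, ?_⟩
  · simp only
    rw [hb, ← hge j, hle _ (hgG j)]
  · rw [Finset.sum_image hinj, Finset.sum_congr rfl fun i hi => by rw [hle i hi],
      hG, Finset.sum_filter_of_ne fun i _ h => by simpa using h]
    simpa [Real.dist_eq] using hFε

end Spectral

/-! ### Coincidences of relabelled multi-indices -/

section Combinatorics

variable {α β : Type*} [Fintype α] [Fintype β] [DecidableEq β]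

/-- The number of times each value is taken by `J`. -/
def fiberCount (J : α → β) (b : β) : ℕ := (Finset.univ.filter fun i => J i = b).card

theorem sum_fiberCount (J : α → β) : ∑ b, fiberCount J b = Fintype.card α :=
  (Finset.card_eq_sum_card_fiberwise fun _ _ => Finset.mem_univ _).symm

theorem prod_comp_eq_prod_pow_fiberCount (J : α → β) (a : β → ℝ) :
    ∏ i, a (J i) = ∏ b, a b ^ fiberCount J b := by
  rw [← Finset.prod_fiberwise' Finset.univ J a]
  simp [fiberCount]

omit [Fintype β] in
theorem exists_perm_of_fiberCount_eq {J J' : α → β} (h : fiberCount J = fiberCount J') :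
    ∃ τ : Equiv.Perm α, J' ∘ τ = J := by
  have h1 : ∀ b, Nonempty ({i // J i = b} ≃ {i // J' i = b}) := by
    intro b
    apply Fintype.card_eq.1
    rw [Fintype.card_subtype, Fintype.card_subtype]
    exact congrFun h b
  have e := fun b => Classical.choice (h1 b)
  exact ⟨Equiv.ofFiberEquiv e, funext fun i => Equiv.ofFiberEquiv_map e i⟩

variable [DecidableEq α]

/-- Burnside count inside one class of functions with the same value counts: the stabilizer sizes
add up to at most the order of the symmetric group. -/
theorem sum_card_stabilizer_le (c : β → ℕ) :
    ∑ J : α → β with fiberCount J = c, (Finset.univ.filter fun σ : Equiv.Perm α => J ∘ σ = J).card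
      ≤ (Fintype.card α).factorial := by
  rcases (Finset.univ.filter fun J : α → β => fiberCount J = c).eq_empty_or_nonempty with h | h
  · rw [h]
    simp
  · obtain ⟨J₀, h₀⟩ := h
    rw [Finset.mem_filter] at h₀
    rw [← Fintype.card_perm, ← Finset.card_univ]
    -- the stabilizer of `J = J₀ ∘ τ` is in bijection with `{σ | J₀ ∘ σ = J}`
    rw [Finset.sum_congr rfl (g := fun J =>
      (Finset.univ.filter fun σ : Equiv.Perm α => J₀ ∘ σ = J).card)]
    · rw [← Finset.card_biUnion]
      · exact Finset.card_le_card (Finset.subset_univ _)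
      · intro J _ J' _ hne
        rw [Function.onFun, Finset.disjoint_left]
        intro σ h1 h2
        rw [Finset.mem_filter] at h1 h2
        exact hne (h1.2.symm.trans h2.2)
    · intro J hJ
      rw [Finset.mem_filter] at hJ
      obtain ⟨τ, hτ⟩ := exists_perm_of_fiberCount_eq (hJ.2.trans h₀.2.symm)
      apply Finset.card_bij' (fun σ _ => τ * σ) (fun σ _ => τ⁻¹ * σ)
      · intro σ hσ
        rw [Finset.mem_filter] at hσ ⊢
        refine ⟨Finset.mem_univ _, ?_⟩
        rw [Equiv.Perm.coe_mul, ← Function.comp_assoc, hτ, hσ.2]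
      · intro σ hσ
        rw [Finset.mem_filter] at hσ ⊢
        refine ⟨Finset.mem_univ _, ?_⟩
        rw [← hτ, Function.comp_assoc, ← Equiv.Perm.coe_mul, mul_inv_cancel_left, hσ.2, hτ]
      · intro σ _
        simp
      · intro σ _
        simp

/-- Weighted form of Burnside's lemma for the symmetric group acting on functions by relabelling the
arguments; orbits are indexed by their value counts. -/
theorem sum_perm_fixed_le (a : β → ℝ) (ha : ∀ b, 0 ≤ a b) :
    ∑ σ : Equiv.Perm α, ∑ J : α → β, (if J ∘ σ = J then ∏ i, a (J i) else 0) ≤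
      (Fintype.card α).factorial *
        ∑ c ∈ (Finset.univ : Finset (α → β)).image fiberCount, ∏ b, a b ^ c b := by
  rw [Finset.sum_comm, Finset.mul_sum,
    ← Finset.sum_fiberwise_of_maps_to
      (fun J _ => Finset.mem_image_of_mem fiberCount (Finset.mem_univ J))]
  apply Finset.sum_le_sum
  intro c _
  have h1 : ∀ J ∈ Finset.univ.filter (fun J : α → β => fiberCount J = c),
      ∑ σ : Equiv.Perm α, (if J ∘ σ = J then ∏ i, a (J i) else 0) =
        ((Finset.univ.filter fun σ : Equiv.Perm α => J ∘ σ = J).card : ℝ) * ∏ b, a b ^ c b := by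
    intro J hJ
    rw [Finset.mem_filter] at hJ
    rw [← Finset.sum_filter, Finset.sum_const, nsmul_eq_mul, prod_comp_eq_prod_pow_fiberCount, hJ.2]
  rw [Finset.sum_congr rfl h1, ← Finset.sum_mul]
  apply mul_le_mul_of_nonneg_right
  · exact_mod_cast sum_card_stabilizer_le (α := α) c
  · exact Finset.prod_nonneg fun b _ => pow_nonneg (ha b) _

/-- The complete homogeneous symmetric polynomial of weights `a`, one of which is `1`, is bounded
by the product of the geometric series of the other weights, whatever its degree. -/
theorem sum_fiberCount_prod_le (a : β → ℝ) (b₀ : β) (h₀ : a b₀ = 1)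
    (ha : ∀ b, 0 ≤ a b) (h1 : ∀ b, b ≠ b₀ → a b < 1) :
    ∑ c ∈ (Finset.univ : Finset (α → β)).image fiberCount, ∏ b, a b ^ c b ≤
      Real.exp (∑ b ∈ Finset.univ.erase b₀, a b / (1 - a b)) := by
  set t : β → Finset ℕ := fun b => if b = b₀ then {0} else Finset.range (Fintype.card α + 1)
    with ht
  -- the total count is fixed, so the count at `b₀` is determined by the others
  have hinj : Set.InjOn (fun c : β → ℕ => Function.update c b₀ 0)
      ((Finset.univ : Finset (α → β)).image fiberCount) := by
    intro c hc c' hc' h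
    rw [Finset.mem_coe, Finset.mem_image] at hc hc'
    obtain ⟨J, -, rfl⟩ := hc
    obtain ⟨J', -, rfl⟩ := hc'
    have hoff : ∀ b, b ≠ b₀ → fiberCount J b = fiberCount J' b := fun b hb => by
      simpa [hb] using congrFun h b
    have e := (sum_fiberCount J).trans (sum_fiberCount J').symm
    rw [← Finset.add_sum_erase _ _ (Finset.mem_univ b₀),
      ← Finset.add_sum_erase _ (fiberCount J') (Finset.mem_univ b₀),
      Finset.sum_congr rfl fun b hb => hoff b (Finset.ne_of_mem_erase hb)] at e
    funext b
    by_cases hb : b = b₀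
    · subst hb
      exact Nat.add_right_cancel e
    · exact hoff b hb
  have hprod : ∀ c : β → ℕ, ∏ b, a b ^ c b = ∏ b, a b ^ Function.update c b₀ 0 b := by
    intro c
    apply Finset.prod_congr rfl
    intro b _
    by_cases hb : b = b₀
    · subst hb
      simp [h₀]
    · simp [hb]
  rw [Finset.sum_congr rfl fun c _ => hprod c,
    ← Finset.sum_image (f := fun c : β → ℕ => ∏ b, a b ^ c b) hinj]
  calc _ ≤ ∑ c ∈ Fintype.piFinset t, ∏ b, a b ^ c b := by
        apply Finset.sum_le_sum_of_subset_of_nonneg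
        · intro c hc
          rw [Finset.mem_image] at hc
          obtain ⟨c, hc, rfl⟩ := hc
          rw [Finset.mem_image] at hc
          obtain ⟨J, -, rfl⟩ := hc
          rw [Fintype.mem_piFinset]
          intro b
          by_cases hb : b = b₀
          · subst hb
            simp [ht]
          · have : fiberCount J b ≤ Fintype.card α := Finset.card_le_univ _
            simp [ht, hb]
            omega
        · intro c _ _
          exact Finset.prod_nonneg fun b _ => pow_nonneg (ha b) _
    _ = ∏ b, ∑ j ∈ t b, a b ^ j := (Finset.prod_univ_sum t fun b j => a b ^ j).symm
    _ = ∏ b ∈ Finset.univ.erase b₀, ∑ j ∈ t b, a b ^ j := by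
        rw [← Finset.mul_prod_erase _ _ (Finset.mem_univ b₀)]
        simp [ht]
    _ ≤ ∏ b ∈ Finset.univ.erase b₀, Real.exp (a b / (1 - a b)) := by
        apply Finset.prod_le_prod
        · intro b _
          exact Finset.sum_nonneg fun j _ => pow_nonneg (ha b) _
        · intro b hb
          have hb1 := h1 b (Finset.ne_of_mem_erase hb)
          have hpos : 0 < 1 - a b := by linarith
          calc ∑ j ∈ t b, a b ^ j ≤ ∑' j, a b ^ j :=
                (summable_geometric_of_lt_one (ha b) hb1).sum_le_tsum _
                  fun j _ => pow_nonneg (ha b) _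
            _ = a b / (1 - a b) + 1 := by
                rw [tsum_geometric_of_lt_one (ha b) hb1]
                field_simp
                ring
            _ ≤ _ := Real.add_one_le_exp _
    _ = _ := (Real.exp_sum _ _).symm

theorem one_add_pow_sub_one_le {x s : ℝ} (hx : 0 ≤ x) (hxs : x ≤ s) (d : ℕ) :
    (1 + x) ^ d - 1 ≤ d * x * Real.exp (d * s) := by
  -- `e^u - 1 ≤ u e^u` for `u = d x`
  have h1 : (1 + x) ^ d ≤ Real.exp (d * x) := by
    rw [Real.exp_nat_mul, add_comm]
    exact pow_le_pow_left₀ (by linarith) (Real.add_one_le_exp x) d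
  have h2 : 1 - d * x ≤ Real.exp (-(d * x)) := by
    have := Real.add_one_le_exp (-(d * x))
    linarith
  have h3 : Real.exp (d * x) ≤ Real.exp (d * s) := by gcongr
  have h4 : Real.exp (d * x) * Real.exp (-(d * x)) = 1 := by
    rw [← Real.exp_add, add_neg_cancel, Real.exp_zero]
  have h5 := mul_le_mul_of_nonneg_left h2 (Real.exp_pos (d * x)).le
  have h6 : 0 ≤ (d : ℝ) * x := by positivity
  nlinarith [mul_le_mul_of_nonneg_left h3 h6]

/-- The spectral sum of a `d`-fold tensor power, in terms of the spectral sum of one factor. Summing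
the geometric series first turns the sum over multi-indices into a `d`-th power. -/
theorem sum_tensor_div_one_sub_le (d : ℕ) (w : β → ℝ) (b₀ : β) (h₀ : w b₀ = 1)
    (hw : ∀ b, 0 ≤ w b) (h1 : ∀ b, b ≠ b₀ → w b < 1) {s : ℝ}
    (hs : ∑ b ∈ Finset.univ.erase b₀, w b / (1 - w b) ≤ s) :
    (∀ I : Fin d → β, I ≠ (fun _ => b₀) → ∏ l, w (I l) < 1) ∧
    ∑ I ∈ (Finset.univ : Finset (Fin d → β)).erase (fun _ => b₀),
      (∏ l, w (I l)) / (1 - ∏ l, w (I l)) ≤ d * s * Real.exp (d * s) := by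
  have hw1 : ∀ b, w b ≤ 1 := fun b => by
    by_cases hb : b = b₀
    · rw [hb, h₀]
    · exact (h1 b hb).le
  have hlt : ∀ I : Fin d → β, I ≠ (fun _ => b₀) → ∏ l, w (I l) < 1 := by
    intro I hI
    obtain ⟨l, hl⟩ := Function.ne_iff.1 hI
    calc ∏ l, w (I l) = w (I l) * ∏ k ∈ Finset.univ.erase l, w (I k) :=
          (Finset.mul_prod_erase _ _ (Finset.mem_univ l)).symm
      _ ≤ w (I l) * 1 := by
          apply mul_le_mul_of_nonneg_left _ (hw _)
          exact Finset.prod_le_one (fun k _ => hw _) (fun k _ => hw1 _)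
      _ < 1 := by rw [mul_one]; exact h1 _ hl
  refine ⟨hlt, ?_⟩
  have geom : ∀ x : ℝ, 0 ≤ x → x < 1 → HasSum (fun m : ℕ => x ^ (m + 1)) (x / (1 - x)) := by
    intro x h0 h1
    simpa [pow_succ', div_eq_mul_inv] using (hasSum_geometric_of_lt_one h0 h1).mul_left x
  set sm : ℕ → ℝ := fun m => ∑ b ∈ Finset.univ.erase b₀, w b ^ (m + 1) with hsm
  have hsmsum : HasSum sm (∑ b ∈ Finset.univ.erase b₀, w b / (1 - w b)) :=
    hasSum_sum fun b hb => geom _ (hw b) (h1 b (Finset.ne_of_mem_erase hb))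
  have hsm0 : ∀ m, 0 ≤ sm m := fun m => Finset.sum_nonneg fun b _ => pow_nonneg (hw b) _
  have hsms : ∀ m, sm m ≤ s := fun m =>
    (le_hasSum hsmsum m fun j _ => hsm0 j).trans hs
  have hL : HasSum (fun m => ∑ I ∈ (Finset.univ : Finset (Fin d → β)).erase (fun _ => b₀),
      (∏ l, w (I l)) ^ (m + 1)) (∑ I ∈ (Finset.univ : Finset (Fin d → β)).erase (fun _ => b₀),
      (∏ l, w (I l)) / (1 - ∏ l, w (I l))) :=
    hasSum_sum fun I hI => geom _ (Finset.prod_nonneg fun l _ => hw _)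
      (hlt I (Finset.ne_of_mem_erase hI))
  have hterm : ∀ m, ∑ I ∈ (Finset.univ : Finset (Fin d → β)).erase (fun _ => b₀),
      (∏ l, w (I l)) ^ (m + 1) = (1 + sm m) ^ d - 1 := by
    intro m
    have e1 : 1 + sm m = ∑ b, w b ^ (m + 1) := by
      rw [hsm, ← Finset.add_sum_erase _ _ (Finset.mem_univ b₀), h₀, one_pow]
    rw [e1, Fintype.sum_pow, ← Finset.add_sum_erase _ _ (Finset.mem_univ (fun _ : Fin d => b₀))]
    simp [h₀, Finset.prod_pow]
  have hR : HasSum (fun m => d * sm m * Real.exp (d * s))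
      (d * (∑ b ∈ Finset.univ.erase b₀, w b / (1 - w b)) * Real.exp (d * s)) :=
    (hsmsum.mul_left _).mul_right _
  refine (hasSum_le (fun m => ?_) hL hR).trans ?_
  · rw [hterm]
    exact one_add_pow_sub_one_le (hsm0 m) (hsms m) d
  · gcongr

/-- The normalised number of coincidences `J ∘ σ = J ∘ τ`, weighted by a tensor power: this is the
second moment of the averaged likelihood, and does not grow with the number `n` of rows. -/
theorem sum_perm_perm_le (n d : ℕ) (w : β → ℝ) (b₀ : β) (h₀ : w b₀ = 1)
    (hw : ∀ b, 0 ≤ w b) (h1 : ∀ b, b ≠ b₀ → w b < 1) {s : ℝ}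
    (hs : ∑ b ∈ Finset.univ.erase b₀, w b / (1 - w b) ≤ s) :
    ∑ σ : Equiv.Perm (Fin n), ∑ τ : Equiv.Perm (Fin n), ∑ J : Fin n → Fin d → β,
      (if J ∘ σ.symm = J ∘ τ.symm then ∏ i, ∏ l, w (J i l) else 0) ≤
      (n.factorial : ℝ) ^ 2 * Real.exp (d * s * Real.exp (d * s)) := by
  obtain ⟨hlt, hsum⟩ := sum_tensor_div_one_sub_le d w b₀ h₀ hw h1 hs
  have ha : ∀ I : Fin d → β, 0 ≤ ∏ l, w (I l) := fun I => Finset.prod_nonneg fun l _ => hw _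
  have hB := (sum_fiberCount_prod_le (α := Fin n) (fun I : Fin d → β => ∏ l, w (I l)) (fun _ => b₀)
    (by simp [h₀]) ha hlt).trans (Real.exp_le_exp.2 hsum)
  have hA := sum_perm_fixed_le (α := Fin n) (fun I : Fin d → β => ∏ l, w (I l)) ha
  rw [Fintype.card_fin] at hA
  have hin : ∀ σ : Equiv.Perm (Fin n), ∑ τ : Equiv.Perm (Fin n), ∑ J : Fin n → Fin d → β,
      (if J ∘ σ.symm = J ∘ τ.symm then ∏ i, ∏ l, w (J i l) else 0) =
      ∑ π : Equiv.Perm (Fin n), ∑ J : Fin n → Fin d → β,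
        (if J ∘ π = J then ∏ i, ∏ l, w (J i l) else 0) := by
    intro σ
    refine Fintype.sum_equiv (Equiv.mulLeft σ⁻¹) _ _ fun τ => ?_
    refine Finset.sum_congr rfl fun J _ => ?_
    have : J ∘ σ.symm = J ∘ τ.symm ↔ J ∘ (Equiv.mulLeft σ⁻¹ τ) = J :=
      Equiv.eq_comp_symm τ (J ∘ σ.symm) J
    simp only [this]
  rw [Finset.sum_congr rfl fun σ _ => hin σ, Finset.sum_const, Finset.card_univ, Fintype.card_perm,
    Fintype.card_fin, nsmul_eq_mul, sq, mul_assoc]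
  gcongr
  exact hA.trans (by gcongr)

end Combinatorics

/-! ### Second moment for kernels of finite rank -/

section SecondMoment

variable {Z : Type*} [MeasurableSpace Z] {ν : Measure Z} [IsProbabilityMeasure ν]
  {ι κ : Type*} [Fintype κ]

theorem memLp_pi_prod {f : κ → Z → ℝ} (hf : ∀ k, MemLp (f k) 2 ν) :
    MemLp (fun x : κ → Z => ∏ k, f k (x k)) 2 (Measure.pi fun _ => ν) := by
  have hm : AEStronglyMeasurable (fun x : κ → Z => ∏ k, f k (x k)) (Measure.pi fun _ => ν) :=
    Finset.aestronglyMeasurable_fun_prod _ fun k _ =>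
      (hf k).1.comp_quasiMeasurePreserving (Measure.quasiMeasurePreserving_eval (fun _ => ν) k)
  rw [memLp_two_iff_integrable_sq hm]
  simp only [← Finset.prod_pow]
  exact Integrable.fintype_prod fun k => (hf k).integrable_sq

/-- Orthonormality in `L²(ν)`, for honest functions rather than their classes: the functions are to
be evaluated at the rows of a database. -/
structure IsOrthonormalFun [DecidableEq ι] (ν : Measure Z) (φ : ι → Z → ℝ) : Prop where
  memLp : ∀ i, MemLp (φ i) 2 ν
  integral_mul : ∀ i j, ∫ x, φ i x * φ j x ∂ν = if i = j then 1 else 0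

theorem IsOrthonormalFun.pi [DecidableEq ι] [DecidableEq κ] {φ : ι → Z → ℝ}
    (h : IsOrthonormalFun ν φ) :
    IsOrthonormalFun (Measure.pi fun _ : κ => ν) (fun (I : κ → ι) x => ∏ k, φ (I k) (x k)) where
  memLp I := memLp_pi_prod fun k => h.memLp (I k)
  integral_mul I J := by
    simp only [← Finset.prod_mul_distrib]
    rw [integral_fintype_prod_eq_prod (fun k x => φ (I k) x * φ (J k) x)]
    simp only [h.integral_mul]
    rw [Finset.prod_ite_zero]
    simp [funext_iff]

/-- The symmetric kernel of finite rank with weights `Λ` and eigenfunctions `φ`. -/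
def rankKernel [Fintype ι] (Λ : ι → ℝ) (φ : ι → Z → ℝ) (p : Z × Z) : ℝ :=
  ∑ i, Λ i * (φ i p.1 * φ i p.2)

omit [MeasurableSpace Z] in
/-- A tensor power of a kernel of finite rank is of finite rank, with multi-indices as indices. -/
theorem prod_rankKernel [Fintype ι] [DecidableEq κ] (Λ : ι → ℝ) (φ : ι → Z → ℝ)
    (w : κ → Z × Z) :
    ∏ k, rankKernel Λ φ (w k) =
      rankKernel (fun I : κ → ι => ∏ k, Λ (I k)) (fun I x => ∏ k, φ (I k) (x k))
        (fun k => (w k).1, fun k => (w k).2) := by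
  simp only [rankKernel]
  rw [Finset.prod_univ_sum, Fintype.piFinset_univ]
  simp only [Finset.prod_mul_distrib]

variable [Fintype ι] [DecidableEq ι] {Λ : ι → ℝ} {φ : ι → Z → ℝ}

omit [Fintype ι] in
theorem IsOrthonormalFun.integral_tensor_mul (h : IsOrthonormalFun ν φ) (a b a' b' : ι) :
    Integrable (fun z : Z × Z => (φ a z.1 * φ b z.2) * (φ a' z.1 * φ b' z.2)) (ν.prod ν) ∧
    ∫ z : Z × Z, (φ a z.1 * φ b z.2) * (φ a' z.1 * φ b' z.2) ∂(ν.prod ν) =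
      if a = a' ∧ b = b' then 1 else 0 := by
  refine ⟨MemLp.integrable_mul (memLp_tensor (h.memLp a) (h.memLp b))
    (memLp_tensor (h.memLp a') (h.memLp b')), ?_⟩
  have e : ∀ z : Z × Z, (φ a z.1 * φ b z.2) * (φ a' z.1 * φ b' z.2) =
      (φ a z.1 * φ a' z.1) * (φ b z.2 * φ b' z.2) := fun z => mul_mul_mul_comm _ _ _ _
  simp only [e]
  rw [integral_prod_mul (fun x => φ a x * φ a' x) (fun y => φ b y * φ b' y), h.integral_mul,
    h.integral_mul, ite_and]
  split_ifs <;> simp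

theorem memLp_rankKernel (h : IsOrthonormalFun ν φ) : MemLp (rankKernel Λ φ) 2 (ν.prod ν) :=
  memLp_finsetSum _ fun i _ => (memLp_tensor (h.memLp i) (h.memLp i)).const_mul (Λ i)

theorem integral_rankKernel_sq (h : IsOrthonormalFun ν φ) :
    ∫ p, rankKernel Λ φ p ^ 2 ∂(ν.prod ν) = ∑ i, Λ i ^ 2 := by
  have e : ∀ p : Z × Z, rankKernel Λ φ p ^ 2 = ∑ i, ∑ j, (Λ i * Λ j) *
      ((φ i p.1 * φ i p.2) * (φ j p.1 * φ j p.2)) := by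
    intro p
    rw [rankKernel, sq, Finset.sum_mul_sum]
    refine Finset.sum_congr rfl fun i _ => Finset.sum_congr rfl fun j _ => ?_
    ring
  simp only [e]
  rw [integral_finsetSum _ fun i _ => integrable_finsetSum _ fun j _ =>
    ((h.integral_tensor_mul i i j j).1.const_mul _)]
  refine Finset.sum_congr rfl fun i _ => ?_
  rw [integral_finsetSum _ fun j _ => ((h.integral_tensor_mul i i j j).1.const_mul _)]
  simp only [integral_const_mul, (h.integral_tensor_mul i i _ _).2]
  simp [sq]

omit [MeasurableSpace Z] [DecidableEq ι] in
/-- Relabelling the rows of the second database permutes the multi-index. -/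
theorem prod_rankKernel_perm {n : ℕ} (x y : Fin n → Z) (σ : Equiv.Perm (Fin n)) :
    ∏ i, rankKernel Λ φ (x i, y (σ i)) = ∑ J : Fin n → ι, (∏ i, Λ (J i)) *
      ((∏ i, φ (J i) (x i)) * ∏ i, φ ((J ∘ σ.symm) i) (y i)) := by
  rw [prod_rankKernel]
  refine Finset.sum_congr rfl fun J _ => ?_
  congr 2
  refine Fintype.prod_equiv σ _ _ fun i => ?_
  simp

/-- Second moment of the sum over all matchings: by orthonormality only the multi-indices `J` with
`J ∘ σ⁻¹ = J ∘ τ⁻¹` contribute to the product of the terms of `σ` and `τ`. -/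
theorem integral_sum_perm_sq (n : ℕ) (h : IsOrthonormalFun ν φ) :
    ∫ z : (Fin n → Z) × (Fin n → Z),
      (∑ σ : Equiv.Perm (Fin n), ∏ i, rankKernel Λ φ (z.1 i, z.2 (σ i))) ^ 2
        ∂((Measure.pi fun _ => ν).prod (Measure.pi fun _ => ν)) =
    ∑ σ : Equiv.Perm (Fin n), ∑ τ : Equiv.Perm (Fin n), ∑ J : Fin n → ι,
      (if J ∘ σ.symm = J ∘ τ.symm then ∏ i, Λ (J i) ^ 2 else 0) := by
  have hpi := h.pi (κ := Fin n)
  have e : ∀ z : (Fin n → Z) × (Fin n → Z),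
      (∑ σ : Equiv.Perm (Fin n), ∏ i, rankKernel Λ φ (z.1 i, z.2 (σ i))) ^ 2 =
      ∑ σ : Equiv.Perm (Fin n), ∑ τ : Equiv.Perm (Fin n), ∑ J : Fin n → ι, ∑ J' : Fin n → ι,
        ((∏ i, Λ (J i)) * ∏ i, Λ (J' i)) *
        (((∏ i, φ (J i) (z.1 i)) * ∏ i, φ ((J ∘ σ.symm) i) (z.2 i)) *
          ((∏ i, φ (J' i) (z.1 i)) * ∏ i, φ ((J' ∘ τ.symm) i) (z.2 i))) := by
    intro z
    simp only [prod_rankKernel_perm]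
    rw [sq, Finset.sum_mul_sum]
    refine Finset.sum_congr rfl fun σ _ => Finset.sum_congr rfl fun τ _ => ?_
    rw [Finset.sum_mul_sum]
    refine Finset.sum_congr rfl fun J _ => Finset.sum_congr rfl fun J' _ => ?_
    ring
  simp only [e]
  have hI : ∀ (σ τ : Equiv.Perm (Fin n)) (J J' : Fin n → ι), _ := fun σ τ J J' =>
    (hpi.integral_tensor_mul J (J ∘ σ.symm) J' (J' ∘ τ.symm))
  rw [integral_finsetSum _ fun σ _ => integrable_finsetSum _ fun τ _ => integrable_finsetSum _
    fun J _ => integrable_finsetSum _ fun J' _ => (hI σ τ J J').1.const_mul _]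
  refine Finset.sum_congr rfl fun σ _ => ?_
  rw [integral_finsetSum _ fun τ _ => integrable_finsetSum _
    fun J _ => integrable_finsetSum _ fun J' _ => (hI σ τ J J').1.const_mul _]
  refine Finset.sum_congr rfl fun τ _ => ?_
  rw [integral_finsetSum _
    fun J _ => integrable_finsetSum _ fun J' _ => (hI σ τ J J').1.const_mul _]
  refine Finset.sum_congr rfl fun J _ => ?_
  rw [integral_finsetSum _ fun J' _ => (hI σ τ J J').1.const_mul _]
  simp only [integral_const_mul, (hI σ τ J _).2]
  rw [Finset.sum_eq_single J]
  · simp only [true_and, mul_ite, mul_one, mul_zero, sq, Finset.prod_mul_distrib]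
  · intro J' _ hne
    rw [if_neg fun h => hne h.1.symm, mul_zero]
  · simp

end SecondMoment

/-! ### Likelihood ratios and the risk of tests -/

section Laws

theorem pi_withDensity {κ Z : Type*} [Fintype κ] [MeasurableSpace Z] {ν : Measure Z}
    [IsProbabilityMeasure ν] {f : Z → ℝ} (h0 : ∀ z, 0 ≤ f z) (hint : Integrable f ν)
    [SigmaFinite (ν.withDensity fun z => ENNReal.ofReal (f z))] :
    Measure.pi (fun _ : κ => ν.withDensity fun z => ENNReal.ofReal (f z)) =
      (Measure.pi fun _ : κ => ν).withDensity fun w => ENNReal.ofReal (∏ k, f (w k)) := by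
  classical
  apply Measure.pi_eq
  intro s hs
  -- on a box the product density is a product of restricted densities, so Fubini applies
  have h1 : ∀ k, (ν.withDensity fun z => ENNReal.ofReal (f z)) (s k) =
      ENNReal.ofReal (∫ z, (s k).indicator f z ∂ν) := by
    intro k
    rw [withDensity_apply _ (hs k), integral_indicator (hs k),
      ofReal_integral_eq_lintegral_ofReal hint.integrableOn (Eventually.of_forall h0)]
  have hI : Integrable (fun w : κ → Z => ∏ k, f (w k)) (Measure.pi fun _ => ν) :=
    Integrable.fintype_prod fun _ => hint
  rw [Finset.prod_congr rfl fun k _ => h1 k, withDensity_apply _ (MeasurableSet.univ_pi hs),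
    ← ofReal_integral_eq_lintegral_ofReal hI.integrableOn
      (Eventually.of_forall fun w => Finset.prod_nonneg fun k _ => h0 _),
    ← ENNReal.ofReal_prod_of_nonneg fun k _ =>
      integral_nonneg fun z => Set.indicator_nonneg (fun z _ => h0 z) z,
    ← integral_fintype_prod_eq_prod (fun k => (s k).indicator f),
    ← integral_indicator (MeasurableSet.univ_pi hs)]
  congr 2
  ext w
  by_cases hw : w ∈ Set.univ.pi s
  · rw [Set.indicator_of_mem hw]
    exact Finset.prod_congr rfl fun k _ => (Set.indicator_of_mem (hw k trivial) f).symm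
  · rw [Set.indicator_of_notMem hw]
    simp only [Set.mem_pi, Set.mem_univ, true_imp_iff, not_forall] at hw
    obtain ⟨k, hk⟩ := hw
    exact (Finset.prod_eq_zero (Finset.mem_univ k) (Set.indicator_of_notMem hk f)).symm

variable {𝒳 : Type*} [MeasurableSpace 𝒳]

/-- The correspondence between an array of matched pairs `w i l = (X_i l, Y_{σ i} l)` and the pair of
databases `(X, Y)`. -/
def unpair (𝒳 : Type*) [MeasurableSpace 𝒳] {n : ℕ} (d : ℕ) (σ : Equiv.Perm (Fin n)) :
    (Fin n → Fin d → 𝒳 × 𝒳) ≃ᵐ Database 𝒳 n d × Database 𝒳 n d where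
  toFun w := (fun i l => (w i l).1, fun j l => (w (σ.symm j) l).2)
  invFun z := fun i l => (z.1 i l, z.2 (σ i) l)
  left_inv w := by simp
  right_inv z := by simp
  measurable_toFun := by
    simp only [Equiv.coe_fn_mk]
    fun_prop
  measurable_invFun := by
    simp only [Equiv.coe_fn_symm_mk]
    fun_prop

theorem measurePreserving_comp_perm {Z : Type*} [MeasurableSpace Z] (ν : Measure Z)
    [IsProbabilityMeasure ν] {n : ℕ} (σ : Equiv.Perm (Fin n)) :
    MeasurePreserving (fun (y : Fin n → Z) j => y (σ.symm j)) (Measure.pi fun _ => ν)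
      (Measure.pi fun _ => ν) := by
  convert measurePreserving_piCongrLeft (fun _ : Fin n => ν) σ using 1
  ext y j
  obtain ⟨i, rfl⟩ := σ.surjective j
  rw [MeasurableEquiv.coe_piCongrLeft, Equiv.piCongrLeft_apply_apply, Equiv.symm_apply_apply]

namespace DistributionPair

variable (D : DistributionPair 𝒳)

/-- The law of an `n × d` array of independent pairs with law `Q_XY`. -/
noncomputable def pairNullLaw (n d : ℕ) : Measure (Fin n → Fin d → 𝒳 × 𝒳) :=
  Measure.pi fun _ => Measure.pi fun _ => D.PX.prod D.PX

instance (n d : ℕ) : IsProbabilityMeasure (D.pairNullLaw n d) := by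
  unfold pairNullLaw; infer_instance

instance (n d : ℕ) : IsProbabilityMeasure (D.nullLaw n d) := by
  unfold nullLaw; infer_instance

theorem measurePreserving_unpair {n : ℕ} (d : ℕ) (σ : Equiv.Perm (Fin n)) :
    MeasurePreserving (unpair 𝒳 d σ) (D.pairNullLaw n d) (D.nullLaw n d) := by
  have h1 := measurePreserving_pi (fun _ : Fin n => Measure.pi fun _ : Fin d => D.PX.prod D.PX)
    (fun _ : Fin n => (Measure.pi fun _ : Fin d => D.PX).prod (Measure.pi fun _ : Fin d => D.PX))
    (fun _ => measurePreserving_arrowProdEquivProdArrow 𝒳 𝒳 (Fin d) (fun _ => D.PX) fun _ => D.PX)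
  have h2 := measurePreserving_arrowProdEquivProdArrow (Fin d → 𝒳) (Fin d → 𝒳) (Fin n)
    (fun _ => Measure.pi fun _ => D.PX) (fun _ => Measure.pi fun _ => D.PX)
  have h3 := (MeasurePreserving.id (Measure.pi fun _ : Fin n => Measure.pi fun _ : Fin d => D.PX)).prod
    (measurePreserving_comp_perm (Measure.pi fun _ : Fin d => D.PX) σ)
  exact h3.comp (h2.comp h1)

theorem memLp_likelihood : MemLp D.likelihood 2 (D.PX.prod D.PX) := D.sq_int

theorem likelihood_nonneg (p : 𝒳 × 𝒳) : 0 ≤ D.likelihood p := ENNReal.toReal_nonneg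

theorem integrable_likelihood : Integrable D.likelihood (D.PX.prod D.PX) :=
  D.memLp_likelihood.integrable (by norm_num)

/-- The likelihood ratio of `H₁` given `σ` against `H₀`. -/
noncomputable def permLikelihood {n d : ℕ} (σ : Equiv.Perm (Fin n))
    (z : Database 𝒳 n d × Database 𝒳 n d) : ℝ :=
  ∏ i, ∏ l, D.likelihood (z.1 i l, z.2 (σ i) l)

theorem permLikelihood_nonneg {n d : ℕ} (σ : Equiv.Perm (Fin n))
    (z : Database 𝒳 n d × Database 𝒳 n d) : 0 ≤ D.permLikelihood σ z :=
  Finset.prod_nonneg fun _ _ => Finset.prod_nonneg fun _ _ => D.likelihood_nonneg _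

/-- Tensor powers of `P_XY` have the tensor powers of the likelihood as density. -/
theorem pi_pi_PXY (n d : ℕ) :
    (Measure.pi fun _ : Fin n => Measure.pi fun _ : Fin d => D.PXY) =
      (D.pairNullLaw n d).withDensity
        fun w => ENNReal.ofReal (∏ i, ∏ l, D.likelihood (w i l)) := by
  have hQ := D.withDensity_likelihood
  have : SigmaFinite ((D.PX.prod D.PX).withDensity
      fun p => ENNReal.ofReal (D.likelihood p)) := by rw [hQ]; infer_instance
  have h1 := pi_withDensity (κ := Fin d) D.likelihood_nonneg D.integrable_likelihood
  rw [hQ] at h1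
  have : SigmaFinite ((Measure.pi fun _ : Fin d => D.PX.prod D.PX).withDensity
      fun w => ENNReal.ofReal (∏ l, D.likelihood (w l))) := by rw [← h1]; infer_instance
  have h2 := pi_withDensity (κ := Fin n) (ν := Measure.pi fun _ : Fin d => D.PX.prod D.PX)
    (f := fun w => ∏ l, D.likelihood (w l))
    (fun w => Finset.prod_nonneg fun _ _ => D.likelihood_nonneg _)
    (Integrable.fintype_prod fun _ => D.integrable_likelihood)
  rw [← h1] at h2
  exact h2

theorem altLaw_apply {n d : ℕ} (σ : Equiv.Perm (Fin n))
    {E : Set (Database 𝒳 n d × Database 𝒳 n d)} (hE : MeasurableSet E) :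
    D.altLaw n d σ E = ∫⁻ z in E, ENNReal.ofReal (D.permLikelihood σ z) ∂D.nullLaw n d := by
  have h : D.altLaw n d σ E =
      (Measure.pi fun _ : Fin n => Measure.pi fun _ : Fin d => D.PXY) (unpair 𝒳 d σ ⁻¹' E) :=
    Measure.map_apply (unpair 𝒳 d σ).measurable hE
  rw [h, pi_pi_PXY, withDensity_apply _ ((unpair 𝒳 d σ).measurable hE),
    ← (D.measurePreserving_unpair d σ).setLIntegral_comp_preimage_emb
      (unpair 𝒳 d σ).measurableEmbedding]
  congr 1
  ext w
  congr 1
  refine Finset.prod_congr rfl fun i _ => Finset.prod_congr rfl fun l _ => ?_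
  congr 1
  simp [unpair]

instance {n d : ℕ} (σ : Equiv.Perm (Fin n)) : IsProbabilityMeasure (D.altLaw n d σ) :=
  Measure.isProbabilityMeasure_map (unpair 𝒳 d σ).measurable.aemeasurable

theorem memLp_pairNullLaw_prod {f : 𝒳 × 𝒳 → ℝ} (hf : MemLp f 2 (D.PX.prod D.PX)) (n d : ℕ) :
    MemLp (fun w : Fin n → Fin d → 𝒳 × 𝒳 => ∏ i, ∏ l, f (w i l)) 2 (D.pairNullLaw n d) := by
  have h1 : MemLp (fun v : Fin d → 𝒳 × 𝒳 => ∏ l, f (v l)) 2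
      (Measure.pi fun _ => D.PX.prod D.PX) := memLp_pi_prod fun _ => hf
  exact memLp_pi_prod (κ := Fin n) fun _ => h1

theorem integral_pairNullLaw_prod (f : 𝒳 × 𝒳 → ℝ) (n d : ℕ) :
    ∫ w, ∏ i, ∏ l, f (w i l) ∂D.pairNullLaw n d = ((∫ p, f p ∂(D.PX.prod D.PX)) ^ d) ^ n := by
  rw [pairNullLaw, integral_fintype_prod_eq_pow (fun v : Fin d → 𝒳 × 𝒳 => ∏ l, f (v l)),
    integral_fintype_prod_eq_pow f, Fintype.card_fin, Fintype.card_fin]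

theorem memLp_permLikelihood {n d : ℕ} (σ : Equiv.Perm (Fin n)) :
    MemLp (D.permLikelihood (d := d) σ) 2 (D.nullLaw n d) :=
  (D.memLp_pairNullLaw_prod D.memLp_likelihood n d).comp_measurePreserving
    ((D.measurePreserving_unpair d σ).symm (unpair 𝒳 d σ))

theorem integrable_permLikelihood {n d : ℕ} (σ : Equiv.Perm (Fin n)) :
    Integrable (D.permLikelihood (d := d) σ) (D.nullLaw n d) :=
  (D.memLp_permLikelihood σ).integrable (by norm_num)

theorem setIntegral_permLikelihood {n d : ℕ} (σ : Equiv.Perm (Fin n))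
    {E : Set (Database 𝒳 n d × Database 𝒳 n d)} (hE : MeasurableSet E) :
    ∫ z in E, D.permLikelihood σ z ∂D.nullLaw n d = (D.altLaw n d σ).real E := by
  rw [measureReal_def, D.altLaw_apply σ hE, integral_eq_lintegral_of_nonneg_ae
    (Eventually.of_forall fun z => D.permLikelihood_nonneg σ z)
    (D.integrable_permLikelihood σ).1.restrict]

/-- If the second moment of the averaged likelihood ratio is at most `1 + ε²`, then by
Cauchy–Schwarz no test has risk less than `1 - ε`. -/
theorem le_minimaxRisk {n d : ℕ} {ε : ℝ} (hε : 0 < ε)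
    (h : ∫ z, (∑ σ : Equiv.Perm (Fin n), D.permLikelihood σ z) ^ 2 ∂D.nullLaw n d ≤
      (n.factorial : ℝ) ^ 2 * (1 + ε ^ 2)) :
    ENNReal.ofReal (1 - ε) ≤ D.minimaxRisk n d := by
  refine le_iInf₂ fun φ hφ => ?_
  set E : Set (Database 𝒳 n d × Database 𝒳 n d) := {z | φ z = false} with hEdef
  have hE : MeasurableSet E := hφ (measurableSet_singleton false)
  have hEc : {z | φ z = true} = Eᶜ := by
    ext z
    simp [hEdef]
  set N : ℝ := (n.factorial : ℝ) with hN
  have hNpos : 0 < N := by positivity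
  set A : Database 𝒳 n d × Database 𝒳 n d → ℝ := fun z => ∑ σ, D.permLikelihood σ z with hA
  have hAmem : MemLp A 2 (D.nullLaw n d) := memLp_finsetSum _ fun σ _ => D.memLp_permLikelihood σ
  set g : Database 𝒳 n d × Database 𝒳 n d → ℝ := fun z => N⁻¹ * A z with hg
  have hgmem : MemLp g 2 (D.nullLaw n d) := hAmem.const_mul _
  have hgint : Integrable g (D.nullLaw n d) := hgmem.integrable (by norm_num)
  have hset : ∀ F : Set (Database 𝒳 n d × Database 𝒳 n d), MeasurableSet F →
      ∫ z in F, g z ∂D.nullLaw n d = N⁻¹ * ∑ σ, (D.altLaw n d σ).real F := by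
    intro F hF
    rw [integral_const_mul, integral_finsetSum _
      fun σ _ => (D.integrable_permLikelihood σ).integrableOn]
    simp only [D.setIntegral_permLikelihood _ hF]
  have hcard : ∑ _σ : Equiv.Perm (Fin n), (1 : ℝ) = N := by
    simp [hN, Fintype.card_perm]
  have hg1 : ∫ z, g z ∂D.nullLaw n d = 1 := by
    rw [← setIntegral_univ, hset _ MeasurableSet.univ]
    simp only [probReal_univ]
    rw [hcard, inv_mul_cancel₀ hNpos.ne']
  have hg2 : ∫ z, g z ^ 2 ∂D.nullLaw n d ≤ 1 + ε ^ 2 := by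
    simp only [hg, mul_pow]
    rw [integral_const_mul]
    calc (N⁻¹) ^ 2 * ∫ z, A z ^ 2 ∂D.nullLaw n d ≤ (N⁻¹) ^ 2 * (N ^ 2 * (1 + ε ^ 2)) := by gcongr
      _ = 1 + ε ^ 2 := by field_simp
  have hdev : ∫ z, (g z - 1) ^ 2 ∂D.nullLaw n d ≤ ε ^ 2 := by
    have e : ∀ z, (g z - 1) ^ 2 = g z ^ 2 - 2 * g z + 1 := fun z => by ring
    simp only [e]
    rw [integral_add (f := fun z => g z ^ 2 - 2 * g z)
      (hgmem.integrable_sq.sub (hgint.const_mul 2)) (integrable_const _),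
      integral_sub hgmem.integrable_sq (hgint.const_mul 2), integral_const_mul, hg1]
    simp
    linarith
  have hdevint : Integrable (fun z => (g z - 1) ^ 2) (D.nullLaw n d) :=
    (hgmem.sub (memLp_const 1)).integrable_sq
  have habs : ∫ z, |g z - 1| ∂D.nullLaw n d ≤ ε := by
    calc ∫ z, |g z - 1| ∂D.nullLaw n d
        ≤ ∫ z, (ε / 2 + (2 * ε)⁻¹ * (g z - 1) ^ 2) ∂D.nullLaw n d := by
          apply integral_mono (hgint.sub (integrable_const 1)).abs
            ((integrable_const _).add (hdevint.const_mul _))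
          intro z
          -- the arithmetic-geometric mean inequality, tight at `|g z - 1| = ε`
          change |g z - 1| ≤ ε / 2 + (2 * ε)⁻¹ * (g z - 1) ^ 2
          rw [← sq_abs (g z - 1)]
          have h2 : ε / 2 + (2 * ε)⁻¹ * |g z - 1| ^ 2 - |g z - 1| =
              (2 * ε)⁻¹ * (|g z - 1| - ε) ^ 2 := by
            field_simp
            ring
          have h3 : 0 ≤ (2 * ε)⁻¹ * (|g z - 1| - ε) ^ 2 := by positivity
          linarith
      _ = ε / 2 + (2 * ε)⁻¹ * ∫ z, (g z - 1) ^ 2 ∂D.nullLaw n d := by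
          rw [integral_add (integrable_const _) (hdevint.const_mul _), integral_const_mul]
          simp
      _ ≤ ε / 2 + (2 * ε)⁻¹ * ε ^ 2 := by gcongr
      _ = ε := by field_simp; ring
  obtain ⟨σ, hσ⟩ : ∃ σ, ∫ z in E, g z ∂D.nullLaw n d ≤ (D.altLaw n d σ).real E := by
    by_contra! hlt
    have h2 := Finset.sum_lt_sum_of_nonempty (Finset.univ_nonempty (α := Equiv.Perm (Fin n)))
      fun σ _ => hlt σ
    rw [hset E hE, ← mul_one (N⁻¹ * _), ← Finset.mul_sum, hcard] at h2
    field_simp at h2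
    exact lt_irrefl _ h2
  have hE1 : (D.nullLaw n d).real E = ∫ z in E, (1 : ℝ) ∂D.nullLaw n d := by simp
  have hdiff : -ε ≤ ∫ z in E, (g z - 1) ∂D.nullLaw n d := by
    have h1 : |∫ z in E, (g z - 1) ∂D.nullLaw n d| ≤ ε :=
      (abs_integral_le_integral_abs).trans <|
        (setIntegral_le_integral (hgint.sub (integrable_const 1)).abs
          (Eventually.of_forall fun z => abs_nonneg _)).trans habs
    exact (abs_le.1 h1).1
  rw [integral_sub hgint.integrableOn (integrable_const 1).integrableOn, ← hE1] at hdiff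
  have hcompl : (D.nullLaw n d).real Eᶜ = 1 - (D.nullLaw n d).real E := probReal_compl_eq_one_sub hE
  calc ENNReal.ofReal (1 - ε)
      ≤ ENNReal.ofReal ((D.nullLaw n d).real Eᶜ + (D.altLaw n d σ).real E) := by
        apply ENNReal.ofReal_le_ofReal
        linarith
    _ = D.nullLaw n d Eᶜ + D.altLaw n d σ E := by
        rw [ENNReal.ofReal_add measureReal_nonneg measureReal_nonneg, ofReal_measureReal,
          ofReal_measureReal]
    _ ≤ D.risk n d φ := by
        rw [risk, hEc]
        gcongr
        exact le_iSup (fun σ => D.altLaw n d σ E) σ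

/-- The test that always accepts `H₀` has risk `1`. -/
theorem minimaxRisk_le_one (n d : ℕ) : D.minimaxRisk n d ≤ 1 := by
  refine (iInf₂_le (fun _ => false) measurable_const).trans ?_
  simp [risk]

end DistributionPair

end Laws

/-! ### Second moment of the likelihood ratio and convergence of the risk -/

section Assembly

/-- Where `∑_{i ≥ 1} λ_i² / (1 - λ_i²)` is finite in `[0, ∞]`, all terms are honest, and finite
partial sums over arbitrary indices other than `0` are bounded by it. -/
theorem spectralSum_bounds {lam : ℕ → ℝ} (hS : spectralSum lam ≠ ⊤) :
    (∀ i, i ≠ 0 → lam i ^ 2 < 1) ∧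
    ∀ s : Finset ℕ, ∑ i ∈ s, (if i = 0 then 0 else lam i ^ 2 / (1 - lam i ^ 2)) ≤
      (spectralSum lam).toReal := by
  have hlt : ∀ i, lam (i + 1) ^ 2 < 1 := by
    intro i
    by_contra! h
    refine ENNReal.ne_top_of_tsum_ne_top hS i ?_
    rw [ENNReal.ofReal_of_nonpos (by linarith : 1 - lam (i + 1) ^ 2 ≤ 0), ENNReal.div_zero]
    simp only [ne_eq, ENNReal.ofReal_eq_zero, not_le]
    linarith
  have hterm : ∀ i, (ENNReal.ofReal (lam (i + 1) ^ 2) / ENNReal.ofReal (1 - lam (i + 1) ^ 2)).toReal =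
      lam (i + 1) ^ 2 / (1 - lam (i + 1) ^ 2) := by
    intro i
    have := hlt i
    rw [ENNReal.toReal_div, ENNReal.toReal_ofReal (sq_nonneg _),
      ENNReal.toReal_ofReal (by linarith)]
  have hnn : ∀ i, 0 ≤ lam (i + 1) ^ 2 / (1 - lam (i + 1) ^ 2) := fun i =>
    div_nonneg (sq_nonneg _) (by linarith [hlt i])
  have hsum : HasSum (fun i => lam (i + 1) ^ 2 / (1 - lam (i + 1) ^ 2)) (spectralSum lam).toReal := by
    simp only [← hterm]
    rw [spectralSum, ENNReal.tsum_toReal_eq (ENNReal.ne_top_of_tsum_ne_top hS)]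
    exact ENNReal.hasSum_toReal hS
  refine ⟨fun i hi => ?_, fun s => ?_⟩
  · obtain ⟨j, rfl⟩ := Nat.exists_eq_succ_of_ne_zero hi
    exact hlt j
  · calc _ ≤ ∑ i ∈ Finset.range (s.sup id + 1 + 1),
          (if i = 0 then 0 else lam i ^ 2 / (1 - lam i ^ 2)) := by
          apply Finset.sum_le_sum_of_subset_of_nonneg
          · intro i hi
            have : i ≤ s.sup id := Finset.le_sup (f := id) hi
            rw [Finset.mem_range]
            omega
          · rintro (_ | i) _ _
            · simp
            · simpa using hnn i
      _ = ∑ i ∈ Finset.range (s.sup id + 1), lam (i + 1) ^ 2 / (1 - lam (i + 1) ^ 2) := by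
          rw [Finset.sum_range_succ']
          simp
      _ ≤ _ := sum_le_hasSum _ (fun i _ => hnn i) hsum

namespace DistributionPair

variable {𝒳 : Type*} [MeasurableSpace 𝒳] (D : DistributionPair 𝒳)

theorem integral_likelihood_sq :
    ∫ p, D.likelihood p ^ 2 ∂(D.PX.prod D.PX) = ‖D.likelihoodLp‖ ^ 2 := by
  rw [← real_inner_self_eq_norm_sq, real_inner_Lp]
  apply integral_congr_ae
  filter_upwards [D.memLp_likelihood.coeFn_toLp] with p hp
  change D.likelihood p ^ 2 = (D.memLp_likelihood.toLp D.likelihood : 𝒳 × 𝒳 → ℝ) p *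
    (D.memLp_likelihood.toLp D.likelihood : 𝒳 × 𝒳 → ℝ) p
  rw [hp, sq]

/-- The squared `L²` distance between the `n * d`-fold tensor powers of the likelihood and of a
function `f` with `‖f‖² = ⟪f, L⟫`, as is the case for orthogonal projections `f` of `L`. -/
theorem integral_prod_sub_prod_sq {f : 𝒳 × 𝒳 → ℝ} (hf : MemLp f 2 (D.PX.prod D.PX)) {q : ℝ}
    (hff : ∫ p, f p ^ 2 ∂(D.PX.prod D.PX) = q)
    (hfL : ∫ p, f p * D.likelihood p ∂(D.PX.prod D.PX) = q) (n d : ℕ) :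
    ∫ w, (∏ i, ∏ l, D.likelihood (w i l) - ∏ i, ∏ l, f (w i l)) ^ 2 ∂D.pairNullLaw n d =
      ((‖D.likelihoodLp‖ ^ 2) ^ d) ^ n - (q ^ d) ^ n := by
  have hP := D.memLp_pairNullLaw_prod D.memLp_likelihood n d
  have hF := D.memLp_pairNullLaw_prod hf n d
  have e : ∀ w : Fin n → Fin d → 𝒳 × 𝒳,
      (∏ i, ∏ l, D.likelihood (w i l) - ∏ i, ∏ l, f (w i l)) ^ 2 =
      (∏ i, ∏ l, D.likelihood (w i l)) ^ 2 -
        2 * ((∏ i, ∏ l, f (w i l)) * ∏ i, ∏ l, D.likelihood (w i l)) +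
        (∏ i, ∏ l, f (w i l)) ^ 2 := fun w => by ring
  have hFP : Integrable (fun w : Fin n → Fin d → 𝒳 × 𝒳 =>
      (∏ i, ∏ l, f (w i l)) * ∏ i, ∏ l, D.likelihood (w i l)) (D.pairNullLaw n d) :=
    MemLp.integrable_mul hF hP
  simp only [e]
  rw [integral_add (f := fun w : Fin n → Fin d → 𝒳 × 𝒳 => (∏ i, ∏ l, D.likelihood (w i l)) ^ 2 -
        2 * ((∏ i, ∏ l, f (w i l)) * ∏ i, ∏ l, D.likelihood (w i l)))
      (hP.integrable_sq.sub (hFP.const_mul 2)) hF.integrable_sq,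
    integral_sub hP.integrable_sq (hFP.const_mul 2), integral_const_mul]
  simp only [← Finset.prod_pow, ← Finset.prod_mul_distrib]
  rw [D.integral_pairNullLaw_prod (fun p => D.likelihood p ^ 2),
    D.integral_pairNullLaw_prod (fun p => f p * D.likelihood p),
    D.integral_pairNullLaw_prod (fun p => f p ^ 2), hff, hfL, D.integral_likelihood_sq]
  ring

/-- Second moment bound up to `δ`, obtained by replacing the likelihood by a kernel of finite rank
that is close to it in `L²`. -/
theorem integral_sum_permLikelihood_sq_le_add {lam : ℕ → ℝ}
    (hlam : IsEigenvalueList D.likelihoodOperator lam) (hS : spectralSum lam ≠ ⊤) (n d : ℕ)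
    {δ : ℝ} (hδ : 0 < δ) :
    ∫ z, (∑ σ : Equiv.Perm (Fin n), D.permLikelihood σ z) ^ 2 ∂D.nullLaw n d ≤
      (n.factorial : ℝ) ^ 2 * ((1 + δ) * Real.exp (d * (spectralSum lam).toReal *
        Real.exp (d * (spectralSum lam).toReal)) + (δ ^ 2 + δ)) := by
  classical
  -- a truncation so close that even the `n * d`-fold tensor powers are within `δ` in `L²`
  have hcont : Continuous fun q : ℝ => (q ^ d) ^ n := by fun_prop
  obtain ⟨η, hη, hηc⟩ := Metric.continuous_iff.1 hcont (‖D.likelihoodLp‖ ^ 2) (δ ^ 2)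
    (by positivity)
  obtain ⟨hlam0, s, h0s, φ, hφ, hTφ, hq⟩ := exists_finset_eigenvectors D hlam hS hη
  set q : ℝ := ∑ i ∈ s, lam i ^ 2 with hqdef
  have hφo : IsOrthonormalFun D.PX (fun i : s => (φ i : 𝒳 → ℝ)) :=
    ⟨fun i => Lp.memLp _, fun i j => by rw [← real_inner_Lp, orthonormal_iff_ite.1 hφ]⟩
  set Λ : s → ℝ := fun i => lam i with hΛ
  set f : 𝒳 × 𝒳 → ℝ := rankKernel Λ (fun i : s => (φ i : 𝒳 → ℝ)) with hfdef
  have hf : MemLp f 2 (D.PX.prod D.PX) := memLp_rankKernel hφo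
  have hff : ∫ p, f p ^ 2 ∂(D.PX.prod D.PX) = q := by
    rw [hfdef, integral_rankKernel_sq hφo, hqdef, ← Finset.sum_coe_sort s]
  have hfL : ∫ p, f p * D.likelihood p ∂(D.PX.prod D.PX) = q := by
    have e : ∀ p, f p * D.likelihood p =
        ∑ i, Λ i * (D.likelihood p * (φ i p.1 * φ i p.2)) := by
      intro p
      rw [hfdef, rankKernel, Finset.sum_mul]
      exact Finset.sum_congr rfl fun i _ => by ring
    simp only [e]
    rw [integral_finsetSum _ fun i _ => (D.integrable_likelihood_mul (φ i) (φ i)).const_mul _,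
      hqdef, ← Finset.sum_coe_sort s]
    refine Finset.sum_congr rfl fun i _ => ?_
    rw [integral_const_mul, ← D.inner_likelihoodLp_tensorLp, ← inner_kernelCLM, hTφ,
      real_inner_smul_left, orthonormal_iff_ite.1 hφ]
    simp [hΛ, sq]
  -- the sum over matchings for the truncated kernel, and its second moment
  set G : Equiv.Perm (Fin n) → Database 𝒳 n d × Database 𝒳 n d → ℝ :=
    fun σ z => ∏ i, ∏ l, f (z.1 i l, z.2 (σ i) l) with hG
  have hGmem : ∀ σ, MemLp (G σ) 2 (D.nullLaw n d) := fun σ =>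
    (D.memLp_pairNullLaw_prod hf n d).comp_measurePreserving
      ((D.measurePreserving_unpair d σ).symm (unpair 𝒳 d σ))
  have hGsq : ∫ z, (∑ σ, G σ z) ^ 2 ∂D.nullLaw n d ≤
      (n.factorial : ℝ) ^ 2 * Real.exp (d * (spectralSum lam).toReal *
        Real.exp (d * (spectralSum lam).toReal)) := by
    have e : ∀ σ z, G σ z = ∏ i, rankKernel (fun I : Fin d → s => ∏ l, Λ (I l))
        (fun I x => ∏ l, (φ (I l) : 𝒳 → ℝ) (x l)) (z.1 i, z.2 (σ i)) := fun σ z =>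
      Finset.prod_congr rfl fun i _ => prod_rankKernel _ _ fun l => (z.1 i l, z.2 (σ i) l)
    simp only [e]
    rw [nullLaw, integral_sum_perm_sq n (hφo.pi (κ := Fin d))]
    simp only [← Finset.prod_pow]
    obtain ⟨hb1, hb2⟩ := spectralSum_bounds hS
    refine sum_perm_perm_le n d (fun i : s => Λ i ^ 2) ⟨0, h0s⟩ (by simp [hΛ, hlam0])
      (fun i => sq_nonneg _) (fun i hi => hb1 i fun h => hi (Subtype.ext h)) ?_
    refine le_of_eq_of_le ?_ (hb2 s)
    rw [← Finset.sum_coe_sort s,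
      ← Finset.add_sum_erase _ _ (Finset.mem_univ (⟨0, h0s⟩ : s)), if_pos rfl, zero_add]
    refine Finset.sum_congr rfl fun i hi => ?_
    rw [if_neg fun h => Finset.ne_of_mem_erase hi (Subtype.ext h)]
  have hdiff : ∀ σ, ∫ z, (D.permLikelihood σ z - G σ z) ^ 2 ∂D.nullLaw n d ≤ δ ^ 2 := by
    intro σ
    rw [← (D.measurePreserving_unpair d σ).integral_comp (unpair 𝒳 d σ).measurableEmbedding]
    have e : ∀ w, (D.permLikelihood σ (unpair 𝒳 d σ w) - G σ (unpair 𝒳 d σ w)) ^ 2 =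
        (∏ i, ∏ l, D.likelihood (w i l) - ∏ i, ∏ l, f (w i l)) ^ 2 := by
      intro w
      simp [permLikelihood, hG, unpair]
    simp only [e]
    rw [D.integral_prod_sub_prod_sq hf hff hfL n d]
    have := hηc q hq
    rw [Real.dist_eq] at this
    linarith [neg_abs_le ((q ^ d) ^ n - ((‖D.likelihoodLp‖ ^ 2) ^ d) ^ n)]
  -- `(a + b)² ≤ (1 + δ) a² + (1 + δ⁻¹) b²`, with the Cauchy–Schwarz inequality for the second term
  have hpt : ∀ z, (∑ σ, D.permLikelihood σ z) ^ 2 ≤ (1 + δ) * (∑ σ, G σ z) ^ 2 +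
      (1 + δ⁻¹) * (n.factorial * ∑ σ, (D.permLikelihood σ z - G σ z) ^ 2) := by
    intro z
    have h1 := sq_sum_le_card_mul_sum_sq (s := Finset.univ)
      (f := fun σ : Equiv.Perm (Fin n) => D.permLikelihood σ z - G σ z)
    rw [Finset.card_univ, Fintype.card_perm, Fintype.card_fin, Finset.sum_sub_distrib] at h1
    set a := ∑ σ, D.permLikelihood σ z
    set b := ∑ σ, G σ z
    have h2 : (1 + δ) * b ^ 2 + (1 + δ⁻¹) * (a - b) ^ 2 - a ^ 2 =
        δ⁻¹ * (δ * b - (a - b)) ^ 2 := by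
      field_simp
      ring
    have h3 : 0 ≤ δ⁻¹ * (δ * b - (a - b)) ^ 2 := by positivity
    have h4 := mul_le_mul_of_nonneg_left h1 (by positivity : 0 ≤ 1 + δ⁻¹)
    linarith
  have hdi : ∀ σ, Integrable (fun z => (D.permLikelihood σ z - G σ z) ^ 2) (D.nullLaw n d) :=
    fun σ => ((D.memLp_permLikelihood σ).sub (hGmem σ)).integrable_sq
  have hsumI : Integrable (fun z => (1 + δ⁻¹) * (n.factorial *
      ∑ σ, (D.permLikelihood σ z - G σ z) ^ 2)) (D.nullLaw n d) :=
    ((integrable_finsetSum _ fun σ _ => hdi σ).const_mul _).const_mul _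
  have hAI : Integrable (fun z => (∑ σ : Equiv.Perm (Fin n), D.permLikelihood σ z) ^ 2)
      (D.nullLaw n d) :=
    (memLp_finsetSum _ fun σ _ => D.memLp_permLikelihood σ).integrable_sq
  have hBI : Integrable (fun z => (∑ σ, G σ z) ^ 2) (D.nullLaw n d) :=
    (memLp_finsetSum _ fun σ _ => hGmem σ).integrable_sq
  calc _ ≤ ∫ z, ((1 + δ) * (∑ σ, G σ z) ^ 2 +
        (1 + δ⁻¹) * (n.factorial * ∑ σ, (D.permLikelihood σ z - G σ z) ^ 2)) ∂D.nullLaw n d :=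
        integral_mono hAI ((hBI.const_mul _).add hsumI) hpt
    _ = (1 + δ) * ∫ z, (∑ σ, G σ z) ^ 2 ∂D.nullLaw n d + (1 + δ⁻¹) * (n.factorial *
        ∑ σ, ∫ z, (D.permLikelihood σ z - G σ z) ^ 2 ∂D.nullLaw n d) := by
        rw [integral_add (hBI.const_mul _) hsumI, integral_const_mul, integral_const_mul,
          integral_const_mul, integral_finsetSum _ fun σ _ => hdi σ]
    _ ≤ (1 + δ) * ((n.factorial : ℝ) ^ 2 * Real.exp (d * (spectralSum lam).toReal *
        Real.exp (d * (spectralSum lam).toReal))) + (1 + δ⁻¹) * (n.factorial *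
        ∑ _σ : Equiv.Perm (Fin n), δ ^ 2) := by
        gcongr with σ
        exact hdiff σ
    _ = _ := by
        rw [Finset.sum_const, Finset.card_univ, Fintype.card_perm, Fintype.card_fin, nsmul_eq_mul]
        field_simp

theorem integral_sum_permLikelihood_sq_le {lam : ℕ → ℝ}
    (hlam : IsEigenvalueList D.likelihoodOperator lam) (n d : ℕ)
    (hS : spectralSum lam * (d : ℝ≥0∞) ≠ ⊤) :
    ∫ z, (∑ σ : Equiv.Perm (Fin n), D.permLikelihood σ z) ^ 2 ∂D.nullLaw n d ≤
      (n.factorial : ℝ) ^ 2 * Real.exp ((spectralSum lam * (d : ℝ≥0∞)).toReal *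
        Real.exp (spectralSum lam * (d : ℝ≥0∞)).toReal) := by
  rcases Nat.eq_zero_or_pos d with rfl | hd
  -- without columns the likelihood ratio is the empty product, and the spectral sum may be infinite
  · simp [permLikelihood, Fintype.card_perm]
  · have hS' : spectralSum lam ≠ ⊤ := by
      intro h
      rw [h, ENNReal.top_mul (by exact_mod_cast hd.ne')] at hS
      exact hS rfl
    have he : (spectralSum lam * (d : ℝ≥0∞)).toReal = d * (spectralSum lam).toReal := by
      rw [ENNReal.toReal_mul, ENNReal.toReal_natCast, mul_comm]
    rw [he]
    set B := Real.exp (d * (spectralSum lam).toReal * Real.exp (d * (spectralSum lam).toReal))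
    have ht : Tendsto (fun δ : ℝ => (n.factorial : ℝ) ^ 2 * ((1 + δ) * B + (δ ^ 2 + δ)))
        (𝓝[>] 0) (𝓝 ((n.factorial : ℝ) ^ 2 * ((1 + 0) * B + (0 ^ 2 + 0)))) :=
      tendsto_nhdsWithin_of_tendsto_nhds (Continuous.tendsto (by fun_prop) 0)
    have := ge_of_tendsto ht (eventually_nhdsWithin_of_forall fun δ hδ =>
      D.integral_sum_permLikelihood_sq_le_add hlam hS' n d hδ)
    simpa using this

end DistributionPair

/-- The risk tends to `1` for arbitrary `n` and `d`, because the second moment bound depends only on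
`d * ∑_{i ≥ 1} λ_i² / (1 - λ_i²)`. -/
theorem tendsto_minimaxRisk {𝒳 : ℕ → Type*} [∀ k, MeasurableSpace (𝒳 k)]
    (D : ∀ k, DistributionPair (𝒳 k)) (d n : ℕ → ℕ) (lam : ℕ → ℕ → ℝ)
    (hlam : ∀ k, IsEigenvalueList (D k).likelihoodOperator (lam k))
    (hcond : Tendsto (fun k => spectralSum (lam k) * (d k : ℝ≥0∞)) atTop (𝓝 0)) :
    Tendsto (fun k => (D k).minimaxRisk (n k) (d k)) atTop (𝓝 1) := by
  have hreal : Tendsto (fun k => (spectralSum (lam k) * (d k : ℝ≥0∞)).toReal) atTop (𝓝 0) :=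
    (ENNReal.tendsto_toReal ENNReal.zero_ne_top).comp hcond
  have hexp : Tendsto (fun k => Real.exp ((spectralSum (lam k) * (d k : ℝ≥0∞)).toReal *
      Real.exp (spectralSum (lam k) * (d k : ℝ≥0∞)).toReal)) atTop (𝓝 1) := by
    have hc : Continuous fun x : ℝ => Real.exp (x * Real.exp x) := by fun_prop
    simpa [Function.comp_def] using (hc.tendsto 0).comp hreal
  have hfin : ∀ᶠ k in atTop, spectralSum (lam k) * (d k : ℝ≥0∞) ≠ ⊤ :=
    (hcond.eventually (gt_mem_nhds ENNReal.zero_lt_top)).mono fun k hk => hk.ne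
  refine tendsto_order.2 ⟨fun a ha => ?_, fun a ha =>
    Eventually.of_forall fun k => ((D k).minimaxRisk_le_one _ _).trans_lt ha⟩
  obtain ⟨ε, hε, haε⟩ : ∃ ε : ℝ, 0 < ε ∧ a < ENNReal.ofReal (1 - ε) := by
    have ht : Tendsto (fun ε : ℝ => ENNReal.ofReal (1 - ε)) (𝓝[>] 0)
        (𝓝 (ENNReal.ofReal (1 - 0))) :=
      tendsto_nhdsWithin_of_tendsto_nhds
        ((ENNReal.continuous_ofReal.comp (by fun_prop : Continuous fun ε : ℝ => 1 - ε)).tendsto 0)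
    rw [sub_zero, ENNReal.ofReal_one] at ht
    obtain ⟨ε, h1, h2⟩ := ((ht.eventually (lt_mem_nhds ha)).and self_mem_nhdsWithin).exists
    exact ⟨ε, h2, h1⟩
  filter_upwards [hfin, hexp.eventually (gt_mem_nhds (by nlinarith : (1 : ℝ) < 1 + ε ^ 2))]
    with k hk1 hk2
  refine haε.trans_le ((D k).le_minimaxRisk hε ?_)
  refine ((D k).integral_sum_permLikelihood_sq_le (hlam k) _ _ hk1).trans ?_
  gcongr

end Assembly

end UnlabeledDatabases

theorem theorem1 {𝒳 : ℕ → Type*} [∀ k, MeasurableSpace (𝒳 k)]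
    (D : ∀ k, UnlabeledDatabases.DistributionPair (𝒳 k)) (d n : ℕ → ℕ) (lam : ℕ → ℕ → ℝ)
    (hlam : ∀ k, UnlabeledDatabases.IsEigenvalueList (D k).likelihoodOperator (lam k))
    (hcond : Tendsto (fun k => UnlabeledDatabases.spectralSum (lam k) * (d k : ℝ≥0∞))
      atTop (𝓝 0)) :
    (Tendsto n atTop atTop →
      Tendsto (fun k => (D k).minimaxRisk (n k) (d k)) atTop (𝓝 1) ∧
        ¬ UnlabeledDatabases.AdmissibleForWeakDetection D d n) ∧
    ((∃ N : ℕ, ∀ k, n k = N) → Tendsto d atTop atTop →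
      Tendsto (fun k => (D k).minimaxRisk (n k) (d k)) atTop (𝓝 1) ∧
        ¬ UnlabeledDatabases.AdmissibleForWeakDetection D d n) := by
  have h := UnlabeledDatabases.tendsto_minimaxRisk D d n lam hlam hcond
  have h' : ¬ UnlabeledDatabases.AdmissibleForWeakDetection D d n := by
    rw [UnlabeledDatabases.AdmissibleForWeakDetection, h.limsup_eq]
    exact lt_irrefl 1
  exact ⟨fun _ => ⟨h, h'⟩, fun _ _ => ⟨h, h'⟩⟩
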